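/- **Setting.** Let $(\mathfrak X,\mathcal S,\pi)$ be a probability space and let $\mathcal B$ be the Banach space of bounded measurable functions $w:\mathfrak X\to\mathbb C$ with $\|w\|=\sup_x|w_x|$. Let $S:\mathcal B\to\mathcal B$ be a bounded linear operator, with operator norm $\|S\|$, such that * **A1**: $\int \overline{u}\,Sw\,d\pi=\int\overline{Su}\,w\,d\pi$ for all $u,w\in\mathcal B$, and $Sp\ge 0$ for every real $p\in\mathcal B$ with $p\ge0$; * **A2**: $(Sw)_x=\int S_{xy}w_y\,\pi(dy)$ for a symmetric measurable kernel $S_{xy}\ge 0$ with $\sup_x\int S_{xy}^2\,\pi(dy)<\infty$. Let $m:\mathbb H\to\mathcal B$, $\mathbb H=\{z\in\mathbb C:\operatorname{Im}z>0\}$, be the solution of the quadratic vector equation with $a=0$, that is, for every $z\in\mathbb H$ and $x\in\mathfrak X$, $$-\frac1{m_x(z)}=z+(Sm(z))_x ,\qquad \operatorname{Im}m_x(z)>0 .$$ Write $|||m|||_{\mathbb R}=\sup_{z\in\mathbb H}\|m(z)\|$ and, with $S_x=S_{x\,\cdot}$ and $\|\cdot\|_2$ the norm of $L^2(\pi)$,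 $$\Gamma(\tau)=\inf_{x}\Big(\int\big(\tfrac1\tau+\|S_y-S_x\|_2\big)^{-2}\pi(dy)\Big)^{1/2}\quad(\tau>0),\qquad \Gamma(0)=0,\qquad \Gamma(\infty)=\lim_{\tau\to\infty}\Gamma(\tau)\in(0,\infty].$$ $\Gamma$ is strictly increasing and continuous; $\Gamma^{-1}$ denotes its inverse on $(0,\Gamma(\infty))$, extended by $\Gamma^{-1}(\lambda)=\infty$ for $\lambda\ge\Gamma(\infty)$. A $K\times K$ matrix with non-negative entries is *fully indecomposable* if for all non-empty $I,J\subset\{1,\dots,K\}$ with $|I|+|J|\ge K$ some entry with row in $I$ and column in $J$ is non-zero. For $\varphi>0$, $K\in\mathbb N$, condition **B1** with parameters $\varphi,K$ says: there are a fully indecomposable matrix $Z\in\{0,1\}^{K\times K}$ and a measurable partition $I_1,\dots,I_K$ of $\mathfrak X$ with $\pi(I_j)=1/K$ and $S_{xy}\ge\varphi Z_{ij}$ for all $(x,y)\in I_i\times I_j$ and all $i,j$. **Theorem.** (i) *(Neighborhood of zero.)* For all $K\in\mathbb N$, $\varphi>0$ and $s>0$ there are constants $\delta>0$ and $\Phi<\infty$,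 depending only on $\varphi$, $K$ and $s$ (so only on $\varphi,K$ under the normalization $\|S\|=1$, where $s=1$), such that for every probability space and every $S$ satisfying A1, A2, $\|S\|\le s$ and B1 with parameters $\varphi,K$: $$\|m(z)\|\le\Phi\qquad\text{for all } z\in\mathbb H,\ |z|\le\delta .$$ (ii) *(Away from zero.)* If $S$ satisfies A1 and A2, then $$\|m(z)\|\le\frac{|z|}2\,\Gamma^{-1}\!\Big(\frac4{|z|^2}\Big)\qquad\text{for all } z\in\mathbb H,\ |z|>\frac2{\sqrt{\Gamma(\infty)}} .$$ In particular, if in the situation of (i) moreover $\Gamma(\infty)>4\delta^{-2}$, then, with $\delta$ and $\Phi$ from (i), $$|||m|||_{\mathbb R}\le\max\Big\{\Phi,\ \frac\delta2\,\Gamma^{-1}\!\Big(\frac4{\delta^2}\Big)\Big\}.$$ -/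

import Mathlib

open MeasureTheory
open scoped ENNReal NNReal

universe u

noncomputable section

namespace QVE

/-- The Banach space of bounded measurable complex-valued functions on `X`, with the supremum
norm. It is a subspace of the space `lp (fun _ : X => ℂ) ∞` of all bounded functions. -/
def boundedMeasurable (X : Type u) [MeasurableSpace X] : Submodule ℂ (lp (fun _ : X => ℂ) ∞) where
  carrier := {w | Measurable (fun x => w x)}
  add_mem' := by
    intro v w hv hw
    exact Measurable.add hv hw
  zero_mem' := by
    exact measurable_const
  smul_mem' := by
    intro c w hw
    exact Measurable.const_smul hw c

/-- The type of elements of the space of bounded measurable functions. -/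
abbrev BB (X : Type u) [MeasurableSpace X] : Type u := boundedMeasurable X

variable {X : Type u} [MeasurableSpace X]

instance : CoeFun (BB X) (fun _ => X → ℂ) := ⟨fun w x => w.1 x⟩

/-- Condition A1: `S` is symmetric with respect to `⟨u, w⟩ = ∫ conj u * w dπ`, and it maps real
non-negative functions to real non-negative functions. -/
structure A1 (π : Measure X) (S : BB X →L[ℂ] BB X) : Prop where
  symm : ∀ u w : BB X,
    ∫ x, (starRingEnd ℂ) (u x) * (S w) x ∂π = ∫ x, (starRingEnd ℂ) ((S u) x) * w x ∂π
  pos : ∀ p : BB X, (∀ x, 0 ≤ (p x).re ∧ (p x).im = 0) →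
    ∀ x, 0 ≤ ((S p) x).re ∧ ((S p) x).im = 0

/-- Condition A2: `S` is the integral operator of the symmetric non-negative measurable kernel `k`
whose rows are bounded in `L²`, uniformly in `x`. The supremum in `bounded` is the norm of `S` as
an operator from `L²(π)` to the bounded functions. -/
structure A2 (π : Measure X) (S : BB X →L[ℂ] BB X) (k : X → X → ℝ) : Prop where
  measurable : Measurable (Function.uncurry k)
  symm : ∀ x y, k x y = k y x
  nonneg : ∀ x y, 0 ≤ k x y
  bounded : ⨆ x, eLpNorm (k x) 2 π < ∞
  apply_eq : ∀ (w : BB X) (x : X), (S w) x = ∫ y, (k x y : ℂ) * w y ∂π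

/-- A square matrix is fully indecomposable if every submatrix with non-empty index sets
`I`, `J` such that `|I| + |J| ≥ K` has a non-zero entry. -/
def FullyIndecomposable {K : ℕ} (T : Matrix (Fin K) (Fin K) ℝ) : Prop :=
  (∀ i j, 0 ≤ T i j) ∧
  ∀ I J : Finset (Fin K), I.Nonempty → J.Nonempty → K ≤ I.card + J.card →
    ∃ i ∈ I, ∃ j ∈ J, T i j ≠ 0

/-- Condition B1: quantitative block full indecomposability, with parameters `φ` and `K`. -/
def B1 (π : Measure X) (k : X → X → ℝ) (φ : ℝ) (K : ℕ) : Prop :=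
  ∃ (Z : Matrix (Fin K) (Fin K) ℝ) (P : Fin K → Set X),
    FullyIndecomposable Z ∧ (∀ i j, Z i j = 0 ∨ Z i j = 1) ∧
    (∀ i, MeasurableSet (P i)) ∧ Pairwise (fun i j => Disjoint (P i) (P j)) ∧
    (⋃ i, P i) = Set.univ ∧
    (∀ i, π (P i) = 1 / (K : ℝ≥0∞)) ∧
    ∀ i j, ∀ x ∈ P i, ∀ y ∈ P j, φ * Z i j ≤ k x y

/-- `m` solves the quadratic vector equation `-1/m(z) = z + a + S m(z)` at every point of the
upper half-plane, with `m(z)` a bounded function taking values in the upper half-plane. -/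
def IsSolution (a : X → ℝ) (S : BB X →L[ℂ] BB X) (m : UpperHalfPlane → BB X) : Prop :=
  ∀ z : UpperHalfPlane, (∀ x, 0 < (m z x).im) ∧
    ∀ x, -(1 / m z x) = (z : ℂ) + (a x : ℂ) + (S (m z)) x

/-- The seminorm `sup {‖w(z)‖ : Re z ∈ I, Im z > 0}`, as an extended number. -/
def stripNorm (I : Set ℝ) (w : UpperHalfPlane → BB X) : ℝ≥0∞ :=
  ⨆ (z : UpperHalfPlane) (_ : z.re ∈ I), ENNReal.ofReal ‖w z‖

/-- The distance `|a_y - a_x| + ‖S_y - S_x‖_2` between rows. -/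
def rowDist (π : Measure X) (a : X → ℝ) (k : X → X → ℝ) (x y : X) : ℝ≥0∞ :=
  ENNReal.ofReal |a y - a x| + eLpNorm (fun u => k y u - k x u) 2 π

/-- The auxiliary function
`Γ(τ) = inf_x (∫ (1/τ + |a_y - a_x| + ‖S_y - S_x‖_2)⁻² π(dy))^(1/2)` on `[0, ∞)`; at `τ = 0` one
has `1/τ = ∞`, so that `Γ(0) = 0`. -/
def Gam (π : Measure X) (a : X → ℝ) (k : X → X → ℝ) (τ : ℝ≥0) : ℝ≥0∞ :=
  ⨅ x, (∫⁻ y, (((τ : ℝ≥0∞)⁻¹ + rowDist π a k x y)⁻¹) ^ 2 ∂π) ^ (1 / 2 : ℝ)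

/-- `Γ(∞)`, the limit of the increasing function `Γ` at infinity (see `Gam_strictMono`). -/
def GamLim (π : Measure X) (a : X → ℝ) (k : X → X → ℝ) : ℝ≥0∞ := ⨆ τ : ℝ≥0, Gam π a k τ

/-- The inverse of `Γ`, extended by `∞` off the range of `Γ`: the preimage of `l` has at most one
element, and `sInf ∅ = ∞` (see `GamInv_Gam`, `Gam_GamInv` and `GamInv_eq_top`). -/
def GamInv (π : Measure X) (a : X → ℝ) (k : X → X → ℝ) (l : ℝ≥0∞) : ℝ≥0∞ :=
  sInf ((fun τ : ℝ≥0 => (τ : ℝ≥0∞)) '' {τ | Gam π a k τ = l})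

/-! Facts that show that `Γ` has an inverse with the stated domain. -/

theorem Gam_scale {π : Measure X} {a : X → ℝ} {k : X → X → ℝ} {s t : ℝ≥0} {c : ℝ≥0}
    (h : ∀ x y, (c : ℝ≥0∞) * ((s : ℝ≥0∞)⁻¹ + rowDist π a k x y)⁻¹
      ≤ ((t : ℝ≥0∞)⁻¹ + rowDist π a k x y)⁻¹) :
    (c : ℝ≥0∞) * Gam π a k s ≤ Gam π a k t := by
  refine le_iInf fun x => ?_
  refine (mul_le_mul_right (iInf_le _ x) (c : ℝ≥0∞)).trans ?_
  have hc : (c : ℝ≥0∞) = ((c : ℝ≥0∞) ^ 2) ^ (1 / 2 : ℝ) := by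
    rw [← ENNReal.rpow_natCast, ← ENNReal.rpow_mul]; norm_num
  rw [hc, ← ENNReal.mul_rpow_of_nonneg _ _ (by norm_num : (0 : ℝ) ≤ 1 / 2)]
  refine ENNReal.rpow_le_rpow ?_ (by norm_num)
  rw [← lintegral_const_mul' _ _ (by simp)]
  refine lintegral_mono fun y => ?_
  have := pow_le_pow_left' (h x y) 2
  rwa [mul_pow] at this

theorem Gam_le {π : Measure X} [IsProbabilityMeasure π] {a : X → ℝ} {k : X → X → ℝ} (τ : ℝ≥0) :
    Gam π a k τ ≤ τ := by
  obtain ⟨x⟩ : Nonempty X := π.nonempty_of_neZero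
  refine (iInf_le _ x).trans ?_
  have h : (∫⁻ y, (((τ : ℝ≥0∞)⁻¹ + rowDist π a k x y)⁻¹) ^ 2 ∂π) ≤ (τ : ℝ≥0∞) ^ 2 := by
    calc _ ≤ ∫⁻ _, (τ : ℝ≥0∞) ^ 2 ∂π := by
          refine lintegral_mono fun y => pow_le_pow_left' ?_ 2
          rw [ENNReal.inv_le_iff_inv_le]
          exact le_self_add
      _ = _ := by simp
  refine (ENNReal.rpow_le_rpow h (by norm_num)).trans ?_
  rw [← ENNReal.rpow_natCast, ← ENNReal.rpow_mul]; norm_num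

theorem Gam_upper {π : Measure X} [IsProbabilityMeasure π] {a : X → ℝ} {k : X → X → ℝ}
    {s t : ℝ≥0} (h : s ≤ t) : Gam π a k t ≤ Gam π a k s + (t - s : ℝ≥0) := by
  rcases eq_or_ne s 0 with rfl | hs
  · refine (Gam_le t).trans ?_
    simp
  have hs' : 0 < s := pos_iff_ne_zero.2 hs
  have ht' : 0 < t := hs'.trans_le h
  have key : ((s / t : ℝ≥0) : ℝ≥0∞) * Gam π a k t ≤ Gam π a k s := by
    refine Gam_scale fun x y => ?_
    set d := rowDist π a k x y
    have e : ((s / t : ℝ≥0) : ℝ≥0∞) = (((t / s : ℝ≥0) : ℝ≥0∞))⁻¹ := by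
      rw [← ENNReal.coe_inv (by positivity)]
      simp
    rw [e, ← ENNReal.mul_inv (by left; simp; exact ⟨ht'.ne', hs⟩) (by left; simp),
      ENNReal.inv_le_inv, mul_add]
    refine add_le_add ?_ ?_
    · rw [← ENNReal.coe_inv hs, ← ENNReal.coe_inv ht'.ne', ← ENNReal.coe_mul,
        ENNReal.coe_le_coe]
      exact le_of_eq (by field_simp)
    · refine le_mul_of_one_le_left zero_le ?_
      rw [← ENNReal.coe_one, ENNReal.coe_le_coe]
      exact (one_le_div hs').2 h
  have hfs : Gam π a k s ≠ ∞ := ((Gam_le s).trans_lt ENNReal.coe_lt_top).ne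
  have hft : Gam π a k t ≠ ∞ := ((Gam_le t).trans_lt ENNReal.coe_lt_top).ne
  have hls := Gam_le (π := π) (a := a) (k := k) s
  lift Gam π a k s to ℝ≥0 using hfs with p
  lift Gam π a k t to ℝ≥0 using hft with q
  norm_cast at key hls ⊢
  rw [← NNReal.coe_le_coe] at key hls h ⊢
  push_cast [NNReal.coe_sub (show s ≤ t from h)] at key hls ⊢
  have hs0 : (0 : ℝ) < s := hs'
  rw [div_mul_eq_mul_div, div_le_iff₀ (by exact_mod_cast ht')] at key
  have : (s : ℝ) * q ≤ s * (p + (t - s)) := by nlinarith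
  exact le_of_mul_le_mul_left this hs0

theorem Gam_pos {π : Measure X} [IsProbabilityMeasure π] {a : X → ℝ} {k : X → X → ℝ} {D : ℝ≥0}
    (hD : ∀ x y, rowDist π a k x y ≤ D) {t : ℝ≥0} (ht : 0 < t) : 0 < Gam π a k t := by
  have h0 : (0 : ℝ≥0∞) < ((t : ℝ≥0∞)⁻¹ + D)⁻¹ := by
    rw [ENNReal.inv_pos]
    simp [ht.ne']
  refine h0.trans_le (le_iInf fun x => ?_)
  have h : (((t : ℝ≥0∞)⁻¹ + D)⁻¹) ^ 2
      ≤ ∫⁻ y, (((t : ℝ≥0∞)⁻¹ + rowDist π a k x y)⁻¹) ^ 2 ∂π := by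
    calc _ = ∫⁻ _, (((t : ℝ≥0∞)⁻¹ + D)⁻¹) ^ 2 ∂π := by simp
      _ ≤ _ := lintegral_mono fun y => pow_le_pow_left'
          (ENNReal.inv_le_inv.2 (add_le_add le_rfl (hD x y))) 2
  refine le_trans (le_of_eq ?_) (ENNReal.rpow_le_rpow h (by norm_num))
  rw [← ENNReal.rpow_natCast, ← ENNReal.rpow_mul]; norm_num

theorem Gam_strictMono {π : Measure X} [IsProbabilityMeasure π] {a : X → ℝ} {k : X → X → ℝ}
    {D : ℝ≥0} (hD : ∀ x y, rowDist π a k x y ≤ D) : StrictMono (Gam π a k) := by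
  intro s t hst
  rcases eq_or_ne s 0 with rfl | hs
  · have : Gam π a k 0 = 0 := le_antisymm (by simpa using Gam_le (π := π) (a := a) (k := k) 0)
      zero_le
    rw [this]
    exact Gam_pos hD hst
  have hs' : 0 < s := pos_iff_ne_zero.2 hs
  have ht' : 0 < t := hs'.trans hst
  have hinv : t⁻¹ < s⁻¹ := (inv_lt_inv₀ ht' hs').2 hst
  have htp : 0 < t⁻¹ := inv_pos.2 ht'
  set c : ℝ≥0 := (s⁻¹ + D) / (t⁻¹ + D) with hc
  have hc1 : 1 < c := by
    rw [hc, one_lt_div (by positivity)]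
    exact add_lt_add_left hinv D
  have key : (c : ℝ≥0∞) * Gam π a k s ≤ Gam π a k t := by
    refine Gam_scale fun x y => ?_
    have hd := hD x y
    have hdt : rowDist π a k x y ≠ ∞ := (hd.trans_lt ENNReal.coe_lt_top).ne
    lift rowDist π a k x y to ℝ≥0 using hdt with d
    rw [ENNReal.coe_le_coe] at hd
    rw [← ENNReal.coe_inv hs, ← ENNReal.coe_inv ht'.ne', ← ENNReal.coe_add, ← ENNReal.coe_add,
      ← ENNReal.coe_inv (by positivity), ← ENNReal.coe_inv (by positivity), ← ENNReal.coe_mul,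
      ENNReal.coe_le_coe, hc, ← div_eq_mul_inv, div_div, ← one_div (t⁻¹ + d),
      div_le_div_iff₀ (by positivity) (by positivity), one_mul]
    rw [← NNReal.coe_le_coe] at hd ⊢
    rw [← NNReal.coe_lt_coe] at hinv
    push_cast at hd hinv ⊢
    nlinarith [mul_nonneg (sub_nonneg.2 hd) (sub_nonneg.2 hinv.le)]
  have hf : Gam π a k s ≠ ∞ := ((Gam_le s).trans_lt ENNReal.coe_lt_top).ne
  have hp := Gam_pos hD hs'
  refine lt_of_lt_of_le ?_ key
  lift Gam π a k s to ℝ≥0 using hf with p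
  norm_cast at hp ⊢
  exact lt_mul_of_one_lt_left hp hc1

/-- In the setting of A2 the rows have uniformly bounded distances if `a` is bounded. -/
theorem rowDist_bounded {π : Measure X} [IsProbabilityMeasure π] {a : X → ℝ} {k : X → X → ℝ}
    {S : BB X →L[ℂ] BB X} (h2 : A2 π S k) {A : ℝ} (ha : ∀ x, |a x| ≤ A) :
    ∃ D : ℝ≥0, ∀ x y, rowDist π a k x y ≤ D := by
  set M := ⨆ x, eLpNorm (k x) 2 π with hM
  have hMt : M ≠ ∞ := h2.bounded.ne
  refine ⟨(ENNReal.ofReal (A + A) + (M + M)).toNNReal, fun x y => ?_⟩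
  rw [ENNReal.coe_toNNReal (by simp [hMt])]
  refine add_le_add (ENNReal.ofReal_le_ofReal ?_) ?_
  · exact (abs_sub _ _).trans (add_le_add (ha y) (ha x))
  · have hm : ∀ z, AEStronglyMeasurable (k z) π := fun z =>
      (h2.measurable.comp measurable_prodMk_left).aestronglyMeasurable
    exact (eLpNorm_sub_le (hm y) (hm x) (by norm_num)).trans
      (add_le_add (le_iSup (fun z => eLpNorm (k z) 2 π) y)
        (le_iSup (fun z => eLpNorm (k z) 2 π) x))

theorem GamInv_Gam {π : Measure X} [IsProbabilityMeasure π] {a : X → ℝ} {k : X → X → ℝ}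
    {D : ℝ≥0} (hD : ∀ x y, rowDist π a k x y ≤ D) (τ : ℝ≥0) :
    GamInv π a k (Gam π a k τ) = τ := by
  have : {t | Gam π a k t = Gam π a k τ} = {τ} := by
    ext t
    exact (Gam_strictMono hD).injective.eq_iff
  simp [GamInv, this]

theorem Gam_GamInv {π : Measure X} [IsProbabilityMeasure π] {a : X → ℝ} {k : X → X → ℝ}
    {D : ℝ≥0} (hD : ∀ x y, rowDist π a k x y ≤ D) {l : ℝ≥0∞} (hl : l < GamLim π a k) :
    ∃ τ : ℝ≥0, Gam π a k τ = l ∧ GamInv π a k l = τ := by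
  have hfin : ∀ t, Gam π a k t ≠ ∞ := fun t => ((Gam_le t).trans_lt ENNReal.coe_lt_top).ne
  have hcont : Continuous (fun t : ℝ≥0 => (Gam π a k t).toReal) := by
    refine LipschitzWith.continuous (K := 1) (LipschitzWith.of_le_add fun t s => ?_)
    rcases le_total s t with h | h
    · have := ENNReal.toReal_mono (by simp [hfin]) (Gam_upper (π := π) (a := a) (k := k) h)
      rw [ENNReal.toReal_add (hfin s) (by simp), ENNReal.coe_toReal, NNReal.coe_sub h] at this
      refine this.trans (add_le_add le_rfl ?_)
      rw [NNReal.dist_eq]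
      exact le_abs_self _
    · have := ENNReal.toReal_mono (hfin s) ((Gam_strictMono hD).monotone h)
      linarith [dist_nonneg (x := t) (y := s)]
  obtain ⟨b, hb⟩ := lt_iSup_iff.1 hl
  have hlt : l ≠ ∞ := (hb.trans_le le_top).ne
  have h0 : Gam π a k 0 = 0 := le_antisymm (by simpa using Gam_le (π := π) (a := a) (k := k) 0)
    zero_le
  obtain ⟨τ, hτ⟩ := mem_range_of_exists_le_of_exists_ge hcont (c := l.toReal)
    ⟨0, by simp [h0]⟩ ⟨b, ENNReal.toReal_mono (hfin b) hb.le⟩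
  have hτ' : Gam π a k τ = l := (ENNReal.toReal_eq_toReal_iff' (hfin τ) hlt).1 hτ
  exact ⟨τ, hτ', by rw [← hτ', GamInv_Gam hD]⟩

theorem GamInv_eq_top {π : Measure X} [IsProbabilityMeasure π] {a : X → ℝ} {k : X → X → ℝ}
    {D : ℝ≥0} (hD : ∀ x y, rowDist π a k x y ≤ D) {l : ℝ≥0∞} (hl : GamLim π a k ≤ l) :
    GamInv π a k l = ∞ := by
  have : {t | Gam π a k t = l} = ∅ := by
    ext t
    refine iff_of_false (fun ht => ?_) (by simp)
    have h1 := Gam_strictMono hD (lt_add_one t)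
    have h2 : Gam π a k (t + 1) ≤ l := (le_iSup (Gam π a k) (t + 1)).trans hl
    exact absurd (h1.trans_le h2) (by rw [show Gam π a k t = l from ht]; exact lt_irrefl l)
  simp [GamInv, this]

end QVE

end

/-! Away from zero. The imaginary part of the equation reads Im m / |m|² = Im z + S Im m. Hence the
kernel |m_x| S_xy |m_y| has the positive supersolution Im m / |m|, and its L² norm is at most one.
Applied to the constant function in z m = -1 - m S m, this yields ‖m‖₂ ≤ 2/|z|
(`IsSol.integral_norm_sq_le`). The values of 1/m at x and y differ by at most ‖S_y - S_x‖₂ ‖m‖₂, so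
a large |m_x| forces |m_y| to be large wherever the rows are similar. Against the L² bound this
gives Γ(2|m_x|/|z|) ≤ 4/|z|² (`IsSol.Gam_le`), and Γ is inverted.

Near zero. At z = it the solution is iv with v > 0 and t v + v S v = 1. Convexity of the exponential
bounds ∫ log v from below (`integral_log_ge`), hence also the product of the block averages of v.
The equation bounds the product of two averages from above whenever Z joins their blocks. Since Z
keeps a perfect matching when a row and the column of the same index are deleted, all averages but
one have a bounded product, so the remaining one is bounded below (`Expanding.sum_le`). Two-sided
bounds on v follow (`exists_bounds`).

Writing m(z) = m(iδ) + v u turns the equation into u + F u = O(|z - iδ|) + O(|u|²), where F has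
kernel v_x S_xy v_y and row sums at most one. The operator 1 + F is bounded below in the supremum
norm (`IsBlocked.abs_le_of_add_kerOp`): a power of F contracts up to the mean, and symmetry of F
controls the mean. So on the half-disc a perturbation of size at most B has size at most B/2.
Continuity of m in z (`IsSol.norm_sub_le`) then keeps it below B on a connected set containing iδ.
As iδ lies inside the half-plane, no extension of m to z = 0 is needed. -/

namespace QVE

variable {X : Type u} [MeasurableSpace X]

/-! ### Bounded functions, kernels and solutions at one spectral parameter -/

/-- Bounded measurable functions. -/
structure IsBM {E : Type*} [Norm E] [MeasurableSpace E] (f : X → E) : Prop where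
  meas : Measurable f
  bdd : ∃ C : ℝ, ∀ x, ‖f x‖ ≤ C

/-- A symmetric non-negative measurable kernel with row integrals bounded by `s`. -/
structure IsKernel (π : Measure X) (k : X → X → ℝ) (s : ℝ) : Prop where
  meas : Measurable (Function.uncurry k)
  symm : ∀ x y, k x y = k y x
  nonneg : ∀ x y, 0 ≤ k x y
  int : ∀ x, Integrable (k x) π
  le : ∀ x, ∫ y, k x y ∂π ≤ s

/-- A solution of the quadratic vector equation with `a = 0` at the spectral parameter `z`. -/
structure IsSol (π : Measure X) (k : X → X → ℝ) (z : ℂ) (m : X → ℂ) : Prop where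
  bm : IsBM m
  im_pos : ∀ x, 0 < (m x).im
  eq : ∀ x, -(1 / m x) = z + ∫ y, (k x y : ℂ) * m y ∂π

section IsBM

theorem IsBM.const (c : ℝ) : IsBM (fun _ : X => c) := ⟨measurable_const, ‖c‖, fun _ => le_rfl⟩

theorem IsBM.add {f g : X → ℝ} (hf : IsBM f) (hg : IsBM g) : IsBM (fun x => f x + g x) := by
  obtain ⟨C, hC⟩ := hf.bdd
  obtain ⟨D, hD⟩ := hg.bdd
  exact ⟨hf.meas.add hg.meas, C + D, fun x => (norm_add_le _ _).trans (add_le_add (hC x) (hD x))⟩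

theorem IsBM.neg {f : X → ℝ} (hf : IsBM f) : IsBM (fun x => -f x) := by
  obtain ⟨C, hC⟩ := hf.bdd
  exact ⟨hf.meas.neg, C, fun x => (norm_neg _).trans_le (hC x)⟩

theorem IsBM.mul {f g : X → ℝ} (hf : IsBM f) (hg : IsBM g) : IsBM (fun x => f x * g x) := by
  obtain ⟨C, hC⟩ := hf.bdd
  obtain ⟨D, hD⟩ := hg.bdd
  refine ⟨hf.meas.mul hg.meas, C * D, fun x => ?_⟩
  rw [norm_mul]
  exact mul_le_mul (hC x) (hD x) (norm_nonneg _) ((norm_nonneg _).trans (hC x))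

theorem IsBM.inv_of_le {f : X → ℝ} (hf : IsBM f) {c : ℝ} (hc : 0 < c) (h : ∀ x, c ≤ f x) :
    IsBM (fun x => (f x)⁻¹) := by
  refine ⟨hf.meas.inv, c⁻¹, fun x => ?_⟩
  rw [norm_inv, Real.norm_of_nonneg (hc.le.trans (h x))]
  exact inv_anti₀ hc (h x)

theorem IsBM.norm {f : X → ℂ} (hf : IsBM f) : IsBM (fun x => ‖f x‖) := by
  obtain ⟨C, hC⟩ := hf.bdd
  exact ⟨hf.meas.norm, C, fun x => by simpa using hC x⟩

theorem IsBM.re {f : X → ℂ} (hf : IsBM f) : IsBM (fun x => (f x).re) := by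
  obtain ⟨C, hC⟩ := hf.bdd
  exact ⟨Complex.measurable_re.comp hf.meas, C, fun x => (Complex.abs_re_le_norm _).trans (hC x)⟩

theorem IsBM.im {f : X → ℂ} (hf : IsBM f) : IsBM (fun x => (f x).im) := by
  obtain ⟨C, hC⟩ := hf.bdd
  exact ⟨Complex.measurable_im.comp hf.meas, C, fun x => (Complex.abs_im_le_norm _).trans (hC x)⟩

theorem IsBM.integrable {π : Measure X} [IsFiniteMeasure π] {f : X → ℝ} (hf : IsBM f) :
    Integrable f π := by
  obtain ⟨C, hC⟩ := hf.bdd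
  exact Integrable.of_bound hf.meas.aestronglyMeasurable C (ae_of_all _ hC)

end IsBM

section IsKernel

variable {π : Measure X} {k : X → X → ℝ} {s : ℝ}

theorem IsKernel.integrable_mul (hk : IsKernel π k s) {w : X → ℝ} (hw : IsBM w) (x : X) :
    Integrable (fun y => k x y * w y) π := by
  obtain ⟨C, hC⟩ := hw.bdd
  exact (hk.int x).mul_bdd (c := C) hw.meas.aestronglyMeasurable (ae_of_all _ hC)

theorem IsKernel.integrable_mul_complex (hk : IsKernel π k s) {w : X → ℂ} (hw : IsBM w) (x : X) :
    Integrable (fun y => (k x y : ℂ) * w y) π := by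
  obtain ⟨C, hC⟩ := hw.bdd
  exact (hk.int x).ofReal.mul_bdd (c := C) hw.meas.aestronglyMeasurable (ae_of_all _ hC)

theorem IsKernel.integral_re (hk : IsKernel π k s) {w : X → ℂ} (hw : IsBM w) (x : X) :
    (∫ y, (k x y : ℂ) * w y ∂π).re = ∫ y, k x y * (w y).re ∂π := by
  have := _root_.integral_re (hk.integrable_mul_complex hw x)
  simpa using this.symm

theorem IsKernel.integral_im (hk : IsKernel π k s) {w : X → ℂ} (hw : IsBM w) (x : X) :
    (∫ y, (k x y : ℂ) * w y ∂π).im = ∫ y, k x y * (w y).im ∂π := by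
  have := _root_.integral_im (hk.integrable_mul_complex hw x)
  simpa using this.symm

theorem IsKernel.norm_integral_le (hk : IsKernel π k s) (w : X → ℂ) (x : X) :
    ‖∫ y, (k x y : ℂ) * w y ∂π‖ ≤ ∫ y, k x y * ‖w y‖ ∂π := by
  refine (norm_integral_le_integral_norm _).trans (le_of_eq ?_)
  congr 1 with y
  rw [norm_mul, Complex.norm_real, Real.norm_of_nonneg (hk.nonneg x y)]

theorem IsKernel.integral_mono (hk : IsKernel π k s) {v w : X → ℝ} (hv : IsBM v) (hw : IsBM w)
    (h : ∀ y, v y ≤ w y) (x : X) : ∫ y, k x y * v y ∂π ≤ ∫ y, k x y * w y ∂π :=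
  MeasureTheory.integral_mono (hk.integrable_mul hv x) (hk.integrable_mul hw x)
    fun y => mul_le_mul_of_nonneg_left (h y) (hk.nonneg x y)

theorem IsKernel.integral_le (hk : IsKernel π k s) {w : X → ℝ} (hw : IsBM w) {C : ℝ} (hC : 0 ≤ C)
    (h : ∀ y, w y ≤ C) (x : X) : ∫ y, k x y * w y ∂π ≤ s * C := by
  refine (hk.integral_mono hw (IsBM.const C) h x).trans ?_
  rw [integral_mul_const]
  exact mul_le_mul_of_nonneg_right (hk.le x) hC

theorem IsKernel.integral_nonneg (hk : IsKernel π k s) {w : X → ℝ} (h : ∀ y, 0 ≤ w y) (x : X) :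
    0 ≤ ∫ y, k x y * w y ∂π :=
  MeasureTheory.integral_nonneg fun y => mul_nonneg (hk.nonneg x y) (h y)

theorem IsKernel.nonneg_bound [IsProbabilityMeasure π] (hk : IsKernel π k s) : 0 ≤ s := by
  obtain ⟨x⟩ : Nonempty X := π.nonempty_of_neZero
  exact (MeasureTheory.integral_nonneg (hk.nonneg x)).trans (hk.le x)

theorem IsKernel.isBM_integral [SFinite π] (hk : IsKernel π k s) {w : X → ℝ} (hw : IsBM w) :
    IsBM (fun x => ∫ y, k x y * w y ∂π) := by
  obtain ⟨C, hC⟩ := hw.bdd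
  refine ⟨?_, s * C, fun x => ?_⟩
  · have : Measurable (Function.uncurry fun x y => k x y * w y) :=
      hk.meas.mul (hw.meas.comp measurable_snd)
    exact this.stronglyMeasurable.integral_prod_right.measurable
  · have hC0 : 0 ≤ C := (norm_nonneg _).trans (hC x)
    refine (norm_integral_le_integral_norm _).trans ?_
    simp_rw [norm_mul, Real.norm_of_nonneg (hk.nonneg x _)]
    exact hk.integral_le ⟨hw.meas.norm, C, fun y => by simpa using hC y⟩ hC0 hC x

theorem IsKernel.integrable_prod [IsFiniteMeasure π] (hk : IsKernel π k s) {G : X × X → ℝ}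
    (hG : IsBM G) : Integrable (fun p : X × X => k p.1 p.2 * G p) (π.prod π) := by
  obtain ⟨C, hC⟩ := hG.bdd
  refine Integrable.mul_bdd (c := C) ?_ hG.meas.aestronglyMeasurable (ae_of_all _ hC)
  have hm : AEStronglyMeasurable (fun p : X × X => k p.1 p.2) (π.prod π) :=
    hk.meas.aestronglyMeasurable
  refine (integrable_prod_iff hm).2 ⟨ae_of_all _ hk.int, ?_⟩
  refine Integrable.of_bound
    (hk.meas.norm.stronglyMeasurable.integral_prod_right.aestronglyMeasurable) s
    (ae_of_all _ fun x => ?_)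
  simp_rw [Real.norm_of_nonneg (hk.nonneg x _)]
  rw [Real.norm_of_nonneg (MeasureTheory.integral_nonneg (hk.nonneg x))]
  exact hk.le x

theorem IsKernel.integral_swap [IsFiniteMeasure π] (hk : IsKernel π k s) {v w : X → ℝ}
    (hv : IsBM v) (hw : IsBM w) :
    ∫ x, v x * ∫ y, k x y * w y ∂π ∂π = ∫ x, w x * ∫ y, k x y * v y ∂π ∂π := by
  have hG : IsBM (fun p : X × X => v p.1 * w p.2) := by
    obtain ⟨C, hC⟩ := hv.bdd
    obtain ⟨D, hD⟩ := hw.bdd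
    refine ⟨(hv.meas.comp measurable_fst).mul (hw.meas.comp measurable_snd), C * D, fun p => ?_⟩
    rw [norm_mul]
    exact mul_le_mul (hC _) (hD _) (norm_nonneg _) ((norm_nonneg _).trans (hC p.1))
  have h := integral_integral_swap (f := fun x y => k x y * (v x * w y)) (hk.integrable_prod hG)
  simp_rw [← integral_const_mul]
  refine Eq.trans ?_ (h.trans ?_)
  · congr with x; congr with y; ring
  · congr with x; congr with y; rw [hk.symm x y]; ring

end IsKernel

/-! ### Elementary bounds on a solution -/

section IsSol

variable {π : Measure X} {k : X → X → ℝ} {s : ℝ} {z : ℂ} {m : X → ℂ}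

theorem IsSol.norm_pos (hm : IsSol π k z m) (x : X) : 0 < ‖m x‖ :=
  norm_pos_iff.2 fun h => by simpa [h] using hm.im_pos x

theorem IsSol.im_eq (hk : IsKernel π k s) (hm : IsSol π k z m) (x : X) :
    (m x).im / ‖m x‖ ^ 2 = z.im + ∫ y, k x y * (m y).im ∂π := by
  have h := congrArg Complex.im (hm.eq x)
  rw [Complex.add_im, hk.integral_im hm.bm] at h
  rw [← h, one_div, Complex.neg_im, Complex.inv_im, Complex.normSq_eq_norm_sq]
  ring

theorem IsSol.le_im (hk : IsKernel π k s) (hm : IsSol π k z m) (x : X) :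
    z.im * ‖m x‖ ^ 2 ≤ (m x).im := by
  have h := hm.im_eq hk x
  have h0 : 0 ≤ ∫ y, k x y * (m y).im ∂π := hk.integral_nonneg (fun y => (hm.im_pos y).le) x
  have hp := hm.norm_pos x
  rw [← le_div_iff₀ (by positivity)]
  linarith

theorem IsSol.norm_le (hk : IsKernel π k s) (hz : 0 < z.im) (hm : IsSol π k z m) (x : X) :
    ‖m x‖ ≤ 1 / z.im := by
  have h := (hm.le_im hk x).trans ((le_abs_self _).trans (Complex.abs_im_le_norm _))
  have hp := hm.norm_pos x
  rw [le_div_iff₀ hz]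
  nlinarith

theorem IsSol.le_norm [IsProbabilityMeasure π] (hk : IsKernel π k s) (hm : IsSol π k z m) {C : ℝ}
    (hC : ∀ x, ‖m x‖ ≤ C) (x : X) : 1 ≤ ‖m x‖ * (‖z‖ + s * C) := by
  have hp := hm.norm_pos x
  have hC0 : 0 ≤ C := hp.le.trans (hC x)
  have h : ‖m x‖⁻¹ ≤ ‖z‖ + s * C := by
    rw [← norm_inv, ← one_div, ← norm_neg, hm.eq x]
    exact (norm_add_le _ _).trans (add_le_add le_rfl ((hk.norm_integral_le _ _).trans
      (hk.integral_le hm.bm.norm hC0 hC x)))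
  calc (1 : ℝ) = ‖m x‖ * ‖m x‖⁻¹ := (mul_inv_cancel₀ hp.ne').symm
    _ ≤ _ := mul_le_mul_of_nonneg_left h hp.le

end IsSol

/-- Evaluating S on the constant function 1 bounds the row integrals by the operator norm. -/
theorem A2.isKernel {π : Measure X} [IsProbabilityMeasure π] {k : X → X → ℝ}
    {S : BB X →L[ℂ] BB X} (h : A2 π S k) {s : ℝ} (hs : ‖S‖ ≤ s) : IsKernel π k s := by
  have hint : ∀ x, Integrable (k x) π := fun x => by
    have : MemLp (k x) 2 π := ⟨(h.measurable.comp measurable_prodMk_left).aestronglyMeasurable,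
      (le_iSup (fun x => eLpNorm (k x) 2 π) x).trans_lt h.bounded⟩
    exact this.integrable (by norm_num)
  refine ⟨h.measurable, h.symm, h.nonneg, hint, fun x => ?_⟩
  let e : BB X := ⟨⟨fun _ => 1, memℓp_infty ⟨1, by rintro _ ⟨x, rfl⟩; simp⟩⟩, measurable_const⟩
  have he : ‖e‖ ≤ 1 := lp.norm_le_of_forall_le zero_le_one fun x => by simp [e]
  have h1 : ‖(S e) x‖ ≤ s * 1 :=
    (lp.norm_apply_le_norm (by simp) (S e).1 x).trans
      ((S.le_opNorm e).trans (mul_le_mul hs he (norm_nonneg _) ((norm_nonneg S).trans hs)))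
  rw [h.apply_eq] at h1
  have h2 : ∫ y, (k x y : ℂ) * e y ∂π = ((∫ y, k x y ∂π : ℝ) : ℂ) := by
    rw [← integral_complex_ofReal]
    simp [e]
  rw [h2, Complex.norm_real, mul_one] at h1
  exact (le_abs_self _).trans h1

theorem BB.norm_apply_le (w : BB X) (x : X) : ‖w x‖ ≤ ‖w‖ :=
  lp.norm_apply_le_norm (by simp) w.1 x

theorem BB.norm_le (w : BB X) {C : ℝ} (hC : 0 ≤ C) (h : ∀ x, ‖w x‖ ≤ C) : ‖w‖ ≤ C :=
  lp.norm_le_of_forall_le hC h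

theorem BB.isBM (w : BB X) : IsBM (fun x => w x) := ⟨w.2, ‖w‖, BB.norm_apply_le w⟩

theorem IsSolution.isSol {π : Measure X} {k : X → X → ℝ} {S : BB X →L[ℂ] BB X} (h : A2 π S k)
    {m : UpperHalfPlane → BB X} (hm : IsSolution (fun _ => 0) S m) (z : UpperHalfPlane) :
    IsSol π k z (fun x => m z x) := by
  refine ⟨BB.isBM _, (hm z).1, fun x => ?_⟩
  rw [(hm z).2 x, h.apply_eq]
  simp

/-! ### The L² bound -/

section L2

variable {π : Measure X} {k : X → X → ℝ} {s : ℝ} {z : ℂ} {m : X → ℂ}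

/-- Cauchy–Schwarz inequality for the rows of a kernel. -/
theorem IsKernel.sq_integral_le (hk : IsKernel π k s) {p q h : X → ℝ} (hp : IsBM p) (hq : IsBM q)
    (hh : IsBM h) (H : ∀ y, ∀ t : ℝ, 2 * t * h y ≤ t ^ 2 * p y + q y) (x : X) :
    (∫ y, k x y * h y ∂π) ^ 2 ≤ (∫ y, k x y * p y ∂π) * ∫ y, k x y * q y ∂π := by
  -- `H` expresses h² ≤ p q as non-negativity of a quadratic polynomial in t, a form that survives
  -- integration; the discriminant of the integrated polynomial gives the claim.
  have key : ∀ t : ℝ, 0 ≤ (∫ y, k x y * p y ∂π) * (t * t) + (-2 * ∫ y, k x y * h y ∂π) * t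
      + ∫ y, k x y * q y ∂π := fun t => by
    have h1 := hk.integral_mono ((IsBM.const (2 * t)).mul hh)
      (((IsBM.const (t ^ 2)).mul hp).add hq) (fun y => H y t) x
    have e1 : ∫ y, k x y * (2 * t * h y) ∂π = 2 * t * ∫ y, k x y * h y ∂π := by
      rw [← integral_const_mul]; congr with y; ring
    have e2 : ∫ y, k x y * (t ^ 2 * p y + q y) ∂π
        = t ^ 2 * (∫ y, k x y * p y ∂π) + ∫ y, k x y * q y ∂π := by
      rw [← integral_const_mul, ← integral_add ((hk.integrable_mul hp x).const_mul _)
        (hk.integrable_mul hq x)]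
      congr with y; ring
    rw [e1, e2] at h1
    linarith
  have := discrim_le_zero key
  rw [discrim] at this
  linarith

/-- Im m ≥ Im z |m|², and |m| is bounded below by the equation. The constant depends on z; it serves
to keep quotients by Im m, and later log Im m, bounded. -/
theorem IsSol.exists_le_im [IsProbabilityMeasure π] (hk : IsKernel π k s) (hz : 0 < z.im)
    (hm : IsSol π k z m) : ∃ c, 0 < c ∧ ∀ x, c ≤ (m x).im := by
  have hs := hk.nonneg_bound
  have hzn : 0 < ‖z‖ := hz.trans_le ((le_abs_self _).trans (Complex.abs_im_le_norm z))
  have hW : 0 < ‖z‖ + s * (1 / z.im) := by positivity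
  refine ⟨z.im * (1 / (‖z‖ + s * (1 / z.im))) ^ 2, by positivity, fun x => ?_⟩
  refine le_trans ?_ (hm.le_im hk x)
  have := hm.le_norm hk (hm.norm_le hk hz) x
  rw [← div_le_iff₀ hW] at this
  gcongr

/-- A Schur test with weight Im m bounds ‖ |m| S|m| ‖₂ by one, and |z| |m| ≤ 1 + |m| S|m| pointwise.
-/
theorem IsSol.integral_norm_sq_le [IsProbabilityMeasure π] (hk : IsKernel π k s) (hz : 0 < z.im)
    (hm : IsSol π k z m) : ‖z‖ ^ 2 * ∫ x, ‖m x‖ ^ 2 ∂π ≤ 4 := by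
  obtain ⟨c, hc, hcm⟩ := hm.exists_le_im hk hz
  have hr := hm.bm.norm
  have hi := hm.bm.im
  have hii := hi.inv_of_le hc hcm
  have hq : IsBM fun x => ‖m x‖ * ‖m x‖ * ((m x).im)⁻¹ := (hr.mul hr).mul hii
  set h : X → ℝ := fun x => ∫ y, k x y * ‖m y‖ ∂π with hh
  have hhb : IsBM h := hk.isBM_integral hr
  -- Cauchy–Schwarz after splitting |m| as √(Im m) · |m|/√(Im m), followed by |m|² S Im m ≤ Im m.
  have hCS : ∀ x, (‖m x‖ * h x) * (‖m x‖ * h x)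
      ≤ (m x).im * ∫ y, k x y * (‖m y‖ * ‖m y‖ * ((m y).im)⁻¹) ∂π := fun x => by
    have h1 := hk.sq_integral_le hi hq hr (fun y t => by
      have hp := hm.im_pos y
      have : t ^ 2 * (m y).im + ‖m y‖ * ‖m y‖ * ((m y).im)⁻¹ - 2 * t * ‖m y‖
          = (t * (m y).im - ‖m y‖) ^ 2 * ((m y).im)⁻¹ := by
        field_simp; ring
      have h0 : 0 ≤ (t * (m y).im - ‖m y‖) ^ 2 * ((m y).im)⁻¹ := by positivity
      linarith) x
    have h2 : ‖m x‖ ^ 2 * ∫ y, k x y * (m y).im ∂π ≤ (m x).im := by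
      have hp := hm.norm_pos x
      rw [mul_comm, ← le_div_iff₀ (by positivity), hm.im_eq hk x]
      linarith
    have hb : 0 ≤ ∫ y, k x y * (‖m y‖ * ‖m y‖ * ((m y).im)⁻¹) ∂π :=
      hk.integral_nonneg (fun y => by have := hm.im_pos y; positivity) x
    calc (‖m x‖ * h x) * (‖m x‖ * h x) = ‖m x‖ ^ 2 * h x ^ 2 := by ring
      _ ≤ ‖m x‖ ^ 2 * _ := mul_le_mul_of_nonneg_left h1 (by positivity)
      _ = (‖m x‖ ^ 2 * ∫ y, k x y * (m y).im ∂π) * _ := by rw [mul_assoc]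
      _ ≤ _ := mul_le_mul_of_nonneg_right h2 hb
  have hg : IsBM fun x => ‖m x‖ * h x := hr.mul hhb
  have hF : ∫ x, (‖m x‖ * h x) * (‖m x‖ * h x) ∂π ≤ 1 := by
    refine (integral_mono (hg.mul hg).integrable
      (hi.mul (hk.isBM_integral hq)).integrable hCS).trans ?_
    -- Symmetry moves S onto Im m, where the same supersolution inequality applies once more.
    rw [hk.integral_swap hi hq]
    refine (integral_mono (hq.mul (hk.isBM_integral hi)).integrable
      (IsBM.const (1 : ℝ)).integrable fun x => ?_).trans (by simp)
    have hp := hm.norm_pos x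
    have hp' := hm.im_pos x
    have h1 : ∫ y, k x y * (m y).im ∂π ≤ (m x).im / ‖m x‖ ^ 2 := by
      rw [hm.im_eq hk x]; linarith
    calc _ ≤ ‖m x‖ * ‖m x‖ * ((m x).im)⁻¹ * ((m x).im / ‖m x‖ ^ 2) :=
          mul_le_mul_of_nonneg_left h1 (by positivity)
      _ = 1 := by field_simp
  have hpt : ∀ x, ‖z‖ ^ 2 * ‖m x‖ ^ 2 ≤ 2 + 2 * ((‖m x‖ * h x) * (‖m x‖ * h x)) := fun x => by
    have hp := hm.norm_pos x
    have h0 : 0 ≤ h x := hk.integral_nonneg (fun y => norm_nonneg _) x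
    have h1 : ‖z‖ ≤ ‖m x‖⁻¹ + h x := by
      have : z = -(1 / m x) - ∫ y, (k x y : ℂ) * m y ∂π := by rw [hm.eq x]; ring
      conv_lhs => rw [this]
      refine (norm_sub_le _ _).trans (add_le_add (by simp) (hk.norm_integral_le _ _))
    have h2 : ‖z‖ * ‖m x‖ ≤ 1 + ‖m x‖ * h x := by
      calc _ ≤ (‖m x‖⁻¹ + h x) * ‖m x‖ := mul_le_mul_of_nonneg_right h1 hp.le
        _ = _ := by field_simp
    have h3 := pow_le_pow_left₀ (by positivity) h2 2
    nlinarith [sq_nonneg (1 - ‖m x‖ * h x)]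
  rw [← integral_const_mul]
  refine (integral_mono ((by simpa only [pow_two] using (hr.mul hr).integrable.const_mul _))
    ((IsBM.const 2).add ((IsBM.const 2).mul (hg.mul hg))).integrable hpt).trans ?_
  rw [integral_add (integrable_const 2) ((hg.mul hg).integrable.const_mul 2), integral_const_mul]
  simp
  linarith

theorem IsSol.lintegral_norm_sq_le [IsProbabilityMeasure π] (hk : IsKernel π k s) (hz : 0 < z.im)
    (hm : IsSol π k z m) : ∫⁻ x, ENNReal.ofReal ‖m x‖ ^ 2 ∂π ≤ ENNReal.ofReal (2 / ‖z‖) ^ 2 := by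
  have hzn : 0 < ‖z‖ := hz.trans_le ((le_abs_self _).trans (Complex.abs_im_le_norm z))
  have h := hm.integral_norm_sq_le hk hz
  simp_rw [← ENNReal.ofReal_pow (norm_nonneg _)]
  rw [← ofReal_integral_eq_lintegral_ofReal
    (by simpa only [pow_two] using (hm.bm.norm.mul hm.bm.norm).integrable)
    (ae_of_all _ fun x => by positivity), ← ENNReal.ofReal_pow (by positivity)]
  refine ENNReal.ofReal_le_ofReal ?_
  rw [div_pow, le_div_iff₀ (by positivity)]
  linarith

end L2

/-! ### Stability, uniqueness and symmetry of solutions -/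

section Lipschitz

variable {π : Measure X} {k : X → X → ℝ} {s : ℝ}

/-- The difference satisfies m - m' = m m' (z - z' + S(m - m')). In the supremum norm weighted by g
= √(Im m Im m') the map w ↦ |m m'| S w is a strict contraction, by Cauchy–Schwarz and the two
imaginary part equations. -/
theorem IsSol.norm_sub_le [IsProbabilityMeasure π] (hk : IsKernel π k s) {z z' : ℂ} {m m' : X → ℂ}
    (hm : IsSol π k z m) (hm' : IsSol π k z' m') {η R : ℝ} (hη : 0 < η) (hz : η ≤ z.im)
    (hz' : η ≤ z'.im) (hR : ‖z‖ ≤ R) (hR' : ‖z'‖ ≤ R) (x : X) :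
    ‖m x - m' x‖ ≤ (R + s * (1 / η)) / η ^ 3 * ‖z - z'‖ := by
  have hs := hk.nonneg_bound
  have hR0 : 0 < R := hη.trans_le (hz.trans ((le_abs_self _).trans
    ((Complex.abs_im_le_norm z).trans hR)))
  set W := R + s * (1 / η) with hW
  have hW0 : 0 < W := by positivity
  have hi := hm.bm.im
  have hi' := hm'.bm.im
  obtain ⟨c, hc, hcm⟩ := hm.exists_le_im hk (hη.trans_le hz)
  obtain ⟨c', hc', hcm'⟩ := hm'.exists_le_im hk (hη.trans_le hz')
  have hup : ∀ x, ‖m x‖ ≤ 1 / η := fun x =>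
    (hm.norm_le hk (hη.trans_le hz) x).trans (one_div_le_one_div_of_le hη hz)
  have hup' : ∀ x, ‖m' x‖ ≤ 1 / η := fun x =>
    (hm'.norm_le hk (hη.trans_le hz') x).trans (one_div_le_one_div_of_le hη hz')
  have hlow : ∀ x, 1 ≤ ‖m x‖ * W := fun x => (hm.le_norm hk hup x).trans (by rw [hW]; gcongr)
  have hlow' : ∀ x, 1 ≤ ‖m' x‖ * W := fun x => (hm'.le_norm hk hup' x).trans (by rw [hW]; gcongr)
  -- the geometric mean of the imaginary parts
  set g : X → ℝ := fun x => Real.sqrt ((m x).im * (m' x).im) with hg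
  have hgpos : ∀ x, 0 < g x := fun x => Real.sqrt_pos.2 (mul_pos (hm.im_pos x) (hm'.im_pos x))
  have hgsq : ∀ x, g x ^ 2 = (m x).im * (m' x).im := fun x =>
    Real.sq_sqrt (mul_pos (hm.im_pos x) (hm'.im_pos x)).le
  have hgup : ∀ x, g x ≤ 1 / η := fun x => by
    rw [hg, Real.sqrt_le_left (by positivity), pow_two]
    exact mul_le_mul (((le_abs_self _).trans (Complex.abs_im_le_norm _)).trans (hup x))
      (((le_abs_self _).trans (Complex.abs_im_le_norm _)).trans (hup' x)) (hm'.im_pos x).le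
      (by positivity)
  have hglow : ∀ x, Real.sqrt (c * c') ≤ g x := fun x =>
    Real.sqrt_le_sqrt (mul_le_mul (hcm x) (hcm' x) hc'.le (hm.im_pos x).le)
  have hgb : IsBM g := ⟨(hi.meas.mul hi'.meas).sqrt, 1 / η, fun x => by
    rw [Real.norm_of_nonneg (hgpos x).le]; exact hgup x⟩
  -- the weighted contraction
  have hcontr : ∀ x, ‖m x‖ * ‖m' x‖ * ∫ y, k x y * g y ∂π ≤ (1 - η / W) * g x := fun x => by
    have hp := hm.norm_pos x
    have hp' := hm'.norm_pos x
    have hCS := hk.sq_integral_le hi hi' hgb (fun y t => by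
      have h1 := hm.im_pos y
      have h2 := hm'.im_pos y
      have e1 := Real.sq_sqrt h1.le
      have e2 := Real.sq_sqrt h2.le
      have e3 : g y = Real.sqrt (m y).im * Real.sqrt (m' y).im := Real.sqrt_mul h1.le _
      rw [e3]
      nlinarith [sq_nonneg (t * Real.sqrt (m y).im - Real.sqrt (m' y).im)]) x
    -- The gain η/W comes from the term Im ζ |n|² of the equation, since |n| ≥ 1/W and |n| ≥ Im n
    -- give |n|² ≥ Im n / W.
    have hone : ∀ {ζ : ℂ} {n : X → ℂ}, IsSol π k ζ n → η ≤ ζ.im → (∀ x, 1 ≤ ‖n x‖ * W) →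
        ‖n x‖ ^ 2 * ∫ y, k x y * (n y).im ∂π ≤ (1 - η / W) * (n x).im := by
      intro ζ n hn hζ hl
      have h1 := hn.im_eq hk x
      have hnp := hn.norm_pos x
      rw [div_eq_iff (by positivity)] at h1
      have h2 : (n x).im ≤ ‖n x‖ := (le_abs_self _).trans (Complex.abs_im_le_norm _)
      have h3 : 1 / W * (n x).im ≤ ‖n x‖ ^ 2 := by
        rw [div_mul_eq_mul_div, one_mul, div_le_iff₀ hW0]
        nlinarith [hl x]
      have h4 : η / W * (n x).im ≤ ζ.im * ‖n x‖ ^ 2 := by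
        calc η / W * (n x).im = η * (1 / W * (n x).im) := by ring
          _ ≤ ζ.im * ‖n x‖ ^ 2 := mul_le_mul hζ h3
            (mul_nonneg (by positivity) (hn.im_pos x).le) (hη.le.trans hζ)
      linarith
    have a1 := hone hm hz hlow
    have a2 := hone hm' hz' hlow'
    have n1 : 0 ≤ ∫ y, k x y * (m y).im ∂π := hk.integral_nonneg (fun y => (hm.im_pos y).le) x
    have n2 : 0 ≤ ∫ y, k x y * (m' y).im ∂π := hk.integral_nonneg (fun y => (hm'.im_pos y).le) x
    have hκ : 0 ≤ 1 - η / W := by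
      by_contra hneg
      have := (mul_nonneg (sq_nonneg ‖m x‖) n1).trans a1
      nlinarith [hm.im_pos x]
    refine le_of_sq_le_sq ?_ (mul_nonneg hκ (hgpos x).le)
    calc _ = ‖m x‖ ^ 2 * ‖m' x‖ ^ 2 * (∫ y, k x y * g y ∂π) ^ 2 := by ring
      _ ≤ ‖m x‖ ^ 2 * ‖m' x‖ ^ 2 * _ := mul_le_mul_of_nonneg_left hCS (by positivity)
      _ = (‖m x‖ ^ 2 * ∫ y, k x y * (m y).im ∂π) * (‖m' x‖ ^ 2 * ∫ y, k x y * (m' y).im ∂π) := by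
        ring
      _ ≤ ((1 - η / W) * (m x).im) * ((1 - η / W) * (m' x).im) :=
        mul_le_mul a1 a2 (mul_nonneg (sq_nonneg _) n2) (mul_nonneg hκ (hm.im_pos x).le)
      _ = ((1 - η / W) * g x) ^ 2 := by rw [mul_pow, hgsq]; ring
  have hfree : ∀ x, ‖m x‖ * ‖m' x‖ ≤ 1 / η * g x := fun x => by
    refine le_of_sq_le_sq ?_ (mul_nonneg (by positivity) (hgpos x).le)
    have a1 : ‖m x‖ ^ 2 ≤ 1 / η * (m x).im := by
      have := hm.le_im hk x
      rw [div_mul_eq_mul_div, one_mul, le_div_iff₀ hη]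
      nlinarith [sq_nonneg ‖m x‖]
    have a2 : ‖m' x‖ ^ 2 ≤ 1 / η * (m' x).im := by
      have := hm'.le_im hk x
      rw [div_mul_eq_mul_div, one_mul, le_div_iff₀ hη]
      nlinarith [sq_nonneg ‖m' x‖]
    rw [mul_pow, mul_pow, hgsq]
    refine (mul_le_mul a1 a2 (sq_nonneg _) ((sq_nonneg _).trans a1)).trans (le_of_eq (by ring))
  -- the weighted distance
  set D : ℝ := ⨆ x, ‖m x - m' x‖ / g x with hD
  have hbdd : BddAbove (Set.range fun x => ‖m x - m' x‖ / g x) := by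
    refine ⟨(1 / η + 1 / η) / Real.sqrt (c * c'), ?_⟩
    rintro _ ⟨y, rfl⟩
    exact div_le_div₀ (by positivity) ((_root_.norm_sub_le _ _).trans (add_le_add (hup y) (hup' y)))
      (Real.sqrt_pos.2 (mul_pos hc hc')) (hglow y)
  have hle : ∀ y, ‖m y - m' y‖ ≤ D * g y := fun y => by
    rw [← div_le_iff₀ (hgpos y)]
    exact le_ciSup hbdd y
  have hD0 : 0 ≤ D := Real.iSup_nonneg fun y => div_nonneg (norm_nonneg _) (hgpos y).le
  have hdb : IsBM fun y => ‖m y - m' y‖ := ⟨(hm.bm.meas.sub hm'.bm.meas).norm, 1 / η + 1 / η,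
    fun y => by
      rw [norm_norm]
      exact (_root_.norm_sub_le _ _).trans (add_le_add (hup y) (hup' y))⟩
  have hstep : ∀ y, ‖m y - m' y‖ ≤ (‖z - z'‖ / η + (1 - η / W) * D) * g y := fun y => by
    have hne : m y ≠ 0 := norm_pos_iff.1 (hm.norm_pos y)
    have hne' : m' y ≠ 0 := norm_pos_iff.1 (hm'.norm_pos y)
    have e : m y - m' y = m y * m' y * ((z - z') + ∫ u, (k y u : ℂ) * (m u - m' u) ∂π) := by
      have h1 := hm.eq y
      have h2 := hm'.eq y
      have h3 : ∫ u, (k y u : ℂ) * (m u - m' u) ∂π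
          = ∫ u, (k y u : ℂ) * m u ∂π - ∫ u, (k y u : ℂ) * m' u ∂π := by
        rw [← integral_sub (hk.integrable_mul_complex hm.bm y)
          (hk.integrable_mul_complex hm'.bm y)]
        simp_rw [mul_sub]
      have h4 : (z - z') + ∫ u, (k y u : ℂ) * (m u - m' u) ∂π = 1 / m' y - 1 / m y := by
        rw [h3]; linear_combination h2 - h1
      rw [h4]; field_simp
    have hI : ‖∫ u, (k y u : ℂ) * (m u - m' u) ∂π‖ ≤ D * ∫ u, k y u * g u ∂π := by
      refine (hk.norm_integral_le _ _).trans
        ((hk.integral_mono hdb ((IsBM.const D).mul hgb) hle y).trans (le_of_eq ?_))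
      rw [← integral_const_mul]; congr with u; ring
    calc ‖m y - m' y‖ = ‖m y‖ * ‖m' y‖ * ‖(z - z') + ∫ u, (k y u : ℂ) * (m u - m' u) ∂π‖ := by
          conv_lhs => rw [e]
          rw [norm_mul, norm_mul]
      _ ≤ ‖m y‖ * ‖m' y‖ * (‖z - z'‖ + D * ∫ u, k y u * g u ∂π) :=
        mul_le_mul_of_nonneg_left ((norm_add_le _ _).trans (add_le_add le_rfl hI)) (by positivity)
      _ = ‖z - z'‖ * (‖m y‖ * ‖m' y‖) + D * (‖m y‖ * ‖m' y‖ * ∫ u, k y u * g u ∂π) := by ring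
      _ ≤ ‖z - z'‖ * (1 / η * g y) + D * ((1 - η / W) * g y) :=
        add_le_add (mul_le_mul_of_nonneg_left (hfree y) (norm_nonneg _))
          (mul_le_mul_of_nonneg_left (hcontr y) hD0)
      _ = _ := by ring
  have hDle : D ≤ ‖z - z'‖ / η + (1 - η / W) * D := by
    have : Nonempty X := ⟨x⟩
    refine ciSup_le fun y => ?_
    rw [div_le_iff₀ (hgpos y)]
    exact hstep y
  have hDf : D ≤ W / η ^ 2 * ‖z - z'‖ := by
    have : η / W * D ≤ ‖z - z'‖ / η := by linarith
    calc D = W / η * (η / W * D) := by field_simp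
      _ ≤ W / η * (‖z - z'‖ / η) := mul_le_mul_of_nonneg_left this (by positivity)
      _ = _ := by field_simp
  calc ‖m x - m' x‖ ≤ D * g x := hle x
    _ ≤ (W / η ^ 2 * ‖z - z'‖) * (1 / η) := mul_le_mul hDf (hgup x) (hgpos x).le (by positivity)
    _ = _ := by field_simp

theorem IsSol.unique [IsProbabilityMeasure π] (hk : IsKernel π k s) {z : ℂ} {m m' : X → ℂ}
    (hz : 0 < z.im) (hm : IsSol π k z m) (hm' : IsSol π k z m') (x : X) : m x = m' x := by
  have h := hm.norm_sub_le hk hm' hz le_rfl le_rfl le_rfl le_rfl x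
  rw [sub_self, norm_zero, mul_zero] at h
  exact sub_eq_zero.1 (norm_le_zero_iff.1 h)

/-- On the imaginary axis the solution is purely imaginary. -/
theorem IsSol.re_eq_zero [IsProbabilityMeasure π] (hk : IsKernel π k s) {t : ℝ} (ht : 0 < t)
    {m : X → ℂ} (hm : IsSol π k (t * Complex.I) m) (x : X) : (m x).re = 0 := by
  -- The point it is fixed by z ↦ -z̄, so -m̄ solves the same equation and uniqueness applies.
  have hm' : IsSol π k (t * Complex.I) fun x => -(starRingEnd ℂ) (m x) := by
    obtain ⟨C, hC⟩ := hm.bm.bdd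
    refine ⟨⟨(Complex.continuous_conj.measurable.comp hm.bm.meas).neg, C, fun x => by
      simpa using hC x⟩, fun x => by simpa using hm.im_pos x, fun x => ?_⟩
    have h := congrArg (fun w => -(starRingEnd ℂ) w) (hm.eq x)
    simp only [map_neg, map_add, map_mul, map_div₀, map_one, Complex.conj_ofReal, Complex.conj_I,
      ← integral_conj] at h
    have e : ∫ y, (k x y : ℂ) * -(starRingEnd ℂ) (m y) ∂π
        = -∫ y, (k x y : ℂ) * (starRingEnd ℂ) (m y) ∂π := by
      rw [← integral_neg]; simp_rw [mul_neg]
    rw [e, one_div_neg_eq_neg_one_div]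
    linear_combination h
  have h := congrArg Complex.re (hm.unique hk (by simpa using ht) hm' x)
  simp at h
  linarith

end Lipschitz

/-! ### From the L² bound to a pointwise bound through Γ -/

section Gamma

variable {π : Measure X} {k : X → X → ℝ} {s : ℝ} {z : ℂ} {m : X → ℂ}

/-- Subtracting the equations at x and y cancels z; Cauchy–Schwarz and ‖m‖₂ ≤ 2/|z| bound what
remains. -/
theorem IsSol.inv_norm_le [IsProbabilityMeasure π] (hk : IsKernel π k s) (hz : 0 < z.im)
    (hm : IsSol π k z m) (x y : X) :
    ENNReal.ofReal ‖m y‖⁻¹ ≤ ENNReal.ofReal ‖m x‖⁻¹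
      + rowDist π (fun _ => 0) k x y * ENNReal.ofReal (2 / ‖z‖) := by
  have hI : ENNReal.ofReal ‖∫ u, ((k y u - k x u : ℝ) : ℂ) * m u ∂π‖
      ≤ rowDist π (fun _ => 0) k x y * ENNReal.ofReal (2 / ‖z‖) := by
    rw [ofReal_norm]
    refine (enorm_integral_le_lintegral_enorm _).trans ?_
    have hkm : ∀ x, Measurable (k x) := fun x => hk.meas.comp measurable_prodMk_left
    have hH := ENNReal.lintegral_mul_le_Lp_mul_Lq π Real.HolderConjugate.two_two
      (f := fun u => ‖k y u - k x u‖ₑ) (g := fun u => ‖m u‖ₑ)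
      ((hkm y).sub (hkm x)).enorm.aemeasurable hm.bm.meas.enorm.aemeasurable
    refine le_trans (lintegral_mono fun u => ?_) (hH.trans ?_)
    · simp only [Pi.mul_apply, enorm_mul]
      gcongr
      rw [← ofReal_norm, Complex.norm_real, ofReal_norm]
    · refine mul_le_mul' ?_ ?_
      · simp only [rowDist, sub_self, abs_zero, ENNReal.ofReal_zero, zero_add]
        rw [eLpNorm_eq_lintegral_rpow_enorm_toReal (by norm_num) (by norm_num)]
        simp
      · have h := ENNReal.rpow_le_rpow (hm.lintegral_norm_sq_le hk hz) (by norm_num : (0:ℝ) ≤ 1 / 2)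
        rw [← ENNReal.rpow_natCast (ENNReal.ofReal (2 / ‖z‖)), ← ENNReal.rpow_mul] at h
        norm_num at h
        simpa [ofReal_norm] using h
  have e : -(1 / m y) = -(1 / m x) + ∫ u, ((k y u - k x u : ℝ) : ℂ) * m u ∂π := by
    rw [hm.eq y, hm.eq x]
    have : ∫ u, ((k y u - k x u : ℝ) : ℂ) * m u ∂π
        = ∫ u, (k y u : ℂ) * m u ∂π - ∫ u, (k x u : ℂ) * m u ∂π := by
      rw [← integral_sub (hk.integrable_mul_complex hm.bm y) (hk.integrable_mul_complex hm.bm x)]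
      simp_rw [← sub_mul, Complex.ofReal_sub]
    rw [this]; ring
  have h := congrArg norm e
  have h2 : ‖m y‖⁻¹ ≤ ‖m x‖⁻¹ + ‖∫ u, ((k y u - k x u : ℝ) : ℂ) * m u ∂π‖ := by
    calc ‖m y‖⁻¹ = ‖-(1 / m y)‖ := by simp
      _ ≤ ‖-(1 / m x)‖ + _ := h.trans_le (norm_add_le _ _)
      _ = _ := by simp
  refine (ENNReal.ofReal_le_ofReal h2).trans ?_
  rw [ENNReal.ofReal_add (by positivity) (norm_nonneg _)]
  gcongr

/-- The value of `Γ` at `2 |m_x(z)| / |z|` is at most `4 / |z|²`. -/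
theorem IsSol.Gam_le [IsProbabilityMeasure π] (hk : IsKernel π k s) (hz : 0 < z.im)
    (hm : IsSol π k z m) (x : X) :
    Gam π (fun _ => 0) k (Real.toNNReal (2 * ‖m x‖ / ‖z‖)) ≤ ENNReal.ofReal (4 / ‖z‖ ^ 2) := by
  have hzn : 0 < ‖z‖ := hz.trans_le ((le_abs_self _).trans (Complex.abs_im_le_norm z))
  have hx := hm.norm_pos x
  set q := ENNReal.ofReal (2 / ‖z‖) with hq
  have hq0 : q ≠ 0 := by rw [hq, ne_eq, ENNReal.ofReal_eq_zero, not_le]; positivity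
  have hqt : q ≠ ∞ := ENNReal.ofReal_ne_top
  -- With q = 2/|z| and τ = q |m_x|, `inv_norm_le` divided by q reads 1/(q|m_y|) ≤ 1/τ + ‖S_y -
  -- S_x‖₂.
  have hpt : ∀ y, ((((Real.toNNReal (2 * ‖m x‖ / ‖z‖) : ℝ≥0) : ℝ≥0∞)⁻¹
      + rowDist π (fun _ => 0) k x y)⁻¹) ≤ q * ENNReal.ofReal ‖m y‖ := fun y => by
    have hy := hm.norm_pos y
    have hmy0 : ENNReal.ofReal ‖m y‖ ≠ 0 := by simpa using hy
    rw [ENNReal.inv_le_iff_inv_le, ENNReal.mul_inv (Or.inl hq0) (Or.inl hqt)]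
    have e : ((Real.toNNReal (2 * ‖m x‖ / ‖z‖) : ℝ≥0) : ℝ≥0∞)⁻¹
        = q⁻¹ * ENNReal.ofReal ‖m x‖⁻¹ := by
      rw [ENNReal.ofReal_inv_of_pos hx, ← ENNReal.mul_inv (Or.inl hq0) (Or.inl hqt), hq,
        ← ENNReal.ofReal_mul (by positivity), ENNReal.ofReal]
      congr 3; ring
    rw [e, ← ENNReal.ofReal_inv_of_pos hy]
    calc q⁻¹ * ENNReal.ofReal ‖m y‖⁻¹
        ≤ q⁻¹ * (ENNReal.ofReal ‖m x‖⁻¹ + rowDist π (fun _ => 0) k x y * q) := by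
          gcongr; exact hm.inv_norm_le hk hz x y
      _ = _ := by
          rw [mul_add, mul_comm _ q, ← mul_assoc, ENNReal.inv_mul_cancel hq0 hqt, one_mul]
  refine (iInf_le _ x).trans ?_
  have h : (∫⁻ y, ((((Real.toNNReal (2 * ‖m x‖ / ‖z‖) : ℝ≥0) : ℝ≥0∞)⁻¹
      + rowDist π (fun _ => 0) k x y)⁻¹) ^ 2 ∂π) ≤ (q ^ 2) ^ 2 := by
    calc _ ≤ ∫⁻ y, q ^ 2 * ENNReal.ofReal ‖m y‖ ^ 2 ∂π :=
          lintegral_mono fun y => (pow_le_pow_left' (hpt y) 2).trans (mul_pow _ _ _).le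
      _ = q ^ 2 * ∫⁻ y, ENNReal.ofReal ‖m y‖ ^ 2 ∂π :=
          lintegral_const_mul' _ _ (ENNReal.pow_ne_top hqt)
      _ ≤ q ^ 2 * q ^ 2 := by gcongr; exact hm.lintegral_norm_sq_le hk hz
      _ = _ := (pow_two _).symm
  refine (ENNReal.rpow_le_rpow h (by norm_num)).trans (le_of_eq ?_)
  rw [← ENNReal.rpow_natCast, ← ENNReal.rpow_mul]
  norm_num
  rw [hq, ← ENNReal.ofReal_pow (by positivity), div_pow]
  norm_num

/-- Sublinear growth of Γ lets the bound at z be compared with the one at a smaller modulus d ≤ |z|,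
which makes the estimate uniform in |z| ≥ d. -/
theorem Gam_mul_le {c t : ℝ≥0} (hc : 1 ≤ c) (a : X → ℝ) :
    Gam π a k (c * t) ≤ c * Gam π a k t := by
  have hc0 : c ≠ 0 := (zero_lt_one.trans_le hc).ne'
  have key : ((c⁻¹ : ℝ≥0) : ℝ≥0∞) * Gam π a k (c * t) ≤ Gam π a k t := by
    refine Gam_scale fun x y => ?_
    rw [ENNReal.coe_inv hc0, ← ENNReal.mul_inv (by simp [hc0]) (by simp), ENNReal.inv_le_inv,
      mul_add, ENNReal.coe_mul, ENNReal.mul_inv (by simp [hc0]) (by simp), ← mul_assoc,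
      ENNReal.mul_inv_cancel (by simp [hc0]) (by simp), one_mul]
    gcongr
    exact le_mul_of_one_le_left zero_le (by exact_mod_cast hc)
  rw [ENNReal.coe_inv hc0, mul_comm, ← div_eq_mul_inv,
    ENNReal.div_le_iff (by simp [hc0]) (by simp)] at key
  exact key.trans_eq (mul_comm _ _)

/-- Bound on a solution at `|z| ≥ d` through the inverse of `Γ` at `4 / d²`. -/
theorem IsSol.norm_le_GamInv [IsProbabilityMeasure π] (hk : IsKernel π k s) (hz : 0 < z.im)
    (hm : IsSol π k z m) {D : ℝ≥0} (hD : ∀ x y, rowDist π (fun _ => 0) k x y ≤ D) {d : ℝ}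
    (hd : 0 < d) (hdz : d ≤ ‖z‖)
    (hlt : ENNReal.ofReal (4 / d ^ 2) < GamLim π (fun _ => 0) k) (x : X) :
    ENNReal.ofReal ‖m x‖
      ≤ ENNReal.ofReal (d / 2) * GamInv π (fun _ => 0) k (ENNReal.ofReal (4 / d ^ 2)) := by
  obtain ⟨τ, hτ, hτ'⟩ := Gam_GamInv hD hlt
  rw [hτ']
  have hzn : 0 < ‖z‖ := hd.trans_le hdz
  set c : ℝ≥0 := Real.toNNReal (‖z‖ / d) with hc
  have hc1 : 1 ≤ c := by
    rw [hc, ← Real.toNNReal_one]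
    exact Real.toNNReal_le_toNNReal ((one_le_div hd).2 hdz)
  -- With c = |z|/d the argument becomes 2|m_x|/d, and c · 4/|z|² = 4/(d|z|) ≤ 4/d².
  have h1 : Gam π (fun _ => 0) k (c * Real.toNNReal (2 * ‖m x‖ / ‖z‖))
      ≤ Gam π (fun _ => 0) k τ := by
    refine (Gam_mul_le hc1 _).trans ?_
    rw [hτ]
    refine (mul_le_mul_right (hm.Gam_le hk hz x) _).trans ?_
    change ENNReal.ofReal _ * _ ≤ _
    rw [← ENNReal.ofReal_mul (by positivity)]
    refine ENNReal.ofReal_le_ofReal ?_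
    rw [div_mul_div_comm, div_le_div_iff₀ (by positivity) (by positivity)]
    nlinarith [mul_le_mul_of_nonneg_left hdz (by positivity : 0 ≤ 4 * ‖z‖ * d)]
  have h2 := (Gam_strictMono hD).le_iff_le.1 h1
  have h3 : 2 * ‖m x‖ / d ≤ τ := by
    have h3 := NNReal.coe_le_coe.2 h2
    rw [NNReal.coe_mul, hc, Real.coe_toNNReal _ (by positivity),
      Real.coe_toNNReal _ (by positivity)] at h3
    refine le_trans (le_of_eq ?_) h3
    field_simp
  rw [← ENNReal.ofReal_coe_nnreal, ← ENNReal.ofReal_mul (by positivity)]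
  refine ENNReal.ofReal_le_ofReal ?_
  rw [div_le_iff₀ hd] at h3
  linarith

theorem BB.ofReal_norm_le (w : BB X) {C : ℝ≥0∞} (h : ∀ x, ENNReal.ofReal ‖w x‖ ≤ C) :
    ENNReal.ofReal ‖w‖ ≤ C := by
  rcases eq_or_ne C ∞ with rfl | hC
  · exact le_top
  rw [ENNReal.ofReal_le_iff_le_toReal hC]
  exact BB.norm_le w ENNReal.toReal_nonneg fun x =>
    (ENNReal.ofReal_le_iff_le_toReal hC).1 (h x)

theorem ofReal_lt_of_two_div_sqrt_lt {G : ℝ≥0∞} {r : ℝ} (hr : 0 < r)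
    (h : 2 / G ^ (1 / 2 : ℝ) < ENNReal.ofReal r) : ENNReal.ofReal (4 / r ^ 2) < G := by
  rcases eq_or_ne G ∞ with rfl | hG
  · exact ENNReal.ofReal_lt_top
  -- For G = 0 the hypothesis fails, because 2/0 = ∞.
  rcases eq_or_ne G 0 with rfl | hG0
  · exact absurd h (by simp [ENNReal.div_zero])
  lift G to ℝ≥0 using hG
  have hG0' : 0 < G := pos_iff_ne_zero.2 (by simpa using hG0)
  rw [← ENNReal.coe_rpow_of_nonneg _ (by norm_num), ← NNReal.sqrt_eq_rpow,
    ENNReal.div_lt_iff (by simp [hG0'.ne']) (by simp)] at h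
  rw [ENNReal.ofReal_lt_iff_lt_toReal (by positivity) (by simp), ENNReal.coe_toReal,
    div_lt_iff₀ (by positivity)]
  rw [show (2 : ℝ≥0∞) = ((2 : ℝ≥0) : ℝ≥0∞) by rfl, ENNReal.ofReal, ← ENNReal.coe_mul,
    ENNReal.coe_lt_coe, ← NNReal.coe_lt_coe, NNReal.coe_mul, Real.coe_toNNReal _ hr.le] at h
  have h2 : (G : ℝ) = (NNReal.sqrt G : ℝ) ^ 2 := by
    rw [← NNReal.coe_pow, NNReal.sq_sqrt]
  rw [h2]
  have h3 := pow_lt_pow_left₀ h (by norm_num) two_ne_zero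
  push_cast at h3
  rw [mul_pow] at h3
  norm_num at h3 ⊢
  linarith

end Gamma

/-! ### Combinatorics of full indecomposability -/

/-- Every sub-rectangle of size at least `K` meets the relation `E`. -/
def Expanding {K : ℕ} (E : Fin K → Fin K → Prop) : Prop :=
  ∀ I J : Finset (Fin K), I.Nonempty → J.Nonempty → K ≤ I.card + J.card → ∃ i ∈ I, ∃ j ∈ J, E i j

section Expanding

variable {K : ℕ} {E : Fin K → Fin K → Prop}

theorem Expanding.flip (hE : Expanding E) : Expanding (fun i j => E j i) := fun I J hI hJ h => by
  obtain ⟨j, hj, i, hi, hij⟩ := hE J I hJ hI (by omega)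
  exact ⟨i, hi, j, hj, hij⟩

-- No edge joins I to the complement of its neighbourhood, so that rectangle must have size below K
-- unless the complement is empty.
open Classical in
theorem Expanding.card_image (hE : Expanding E) {I : Finset (Fin K)} (hI : I.Nonempty) :
    min (I.card + 1) K ≤ (Finset.univ.filter fun j => ∃ i ∈ I, E i j).card := by
  set N := Finset.univ.filter fun j => ∃ i ∈ I, E i j with hN
  have hc : N.card + Nᶜ.card = K := by simp [Finset.card_add_card_compl]
  rcases Nᶜ.eq_empty_or_nonempty with h | h
  · rw [h, Finset.card_empty] at hc
    omega
  · by_contra hlt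
    obtain ⟨i, hi, j, hj, hij⟩ := hE I Nᶜ hI h (by omega)
    rw [Finset.mem_compl] at hj
    exact hj (Finset.mem_filter.2 ⟨Finset.mem_univ _, i, hi, hij⟩)

theorem Expanding.exists_right (hE : Expanding E) (i : Fin K) : ∃ j, E i j := by
  obtain ⟨i', hi', j, -, h⟩ := hE {i} Finset.univ (by simp) ⟨i, by simp⟩ (by simp)
  rw [Finset.mem_singleton] at hi'
  exact ⟨j, hi' ▸ h⟩

open Classical in
/-- A potential that is non-positive on the edges of an expanding relation is bounded below by its
total sum: the relation with one row and the corresponding column removed has a perfect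
matching. -/
theorem Expanding.sum_le (hE : Expanding E) {b : Fin K → ℝ} (hb : ∀ i j, E i j → b i + b j ≤ 0)
    (i₀ : Fin K) : ∑ i, b i ≤ b i₀ := by
  let t : {i : Fin K // i ≠ i₀} → Finset (Fin K) := fun i =>
    Finset.univ.filter fun j => E i j ∧ j ≠ i₀
  -- Hall's condition: deleting the column i₀ costs at most one neighbour, which the strict
  -- expansion of `card_image` compensates.
  have hall : ∀ I : Finset {i : Fin K // i ≠ i₀}, I.card ≤ (I.biUnion t).card := by
    intro I
    rcases I.eq_empty_or_nonempty with rfl | hI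
    · simp
    set I' : Finset (Fin K) := I.image Subtype.val with hI'
    have hcard : I'.card = I.card := Finset.card_image_of_injective _ Subtype.val_injective
    have h1 := hE.card_image (I := I') (hI.image _)
    have h2 : I'.card + 1 ≤ K := by
      have : I' ⊆ Finset.univ.erase i₀ := fun j hj => by
        obtain ⟨i, -, rfl⟩ := Finset.mem_image.1 hj
        exact Finset.mem_erase.2 ⟨i.2, Finset.mem_univ _⟩
      have := Finset.card_le_card this
      rw [Finset.card_erase_of_mem (Finset.mem_univ _), Finset.card_univ, Fintype.card_fin] at this
      have := i₀.pos
      omega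
    have h3 : (Finset.univ.filter fun j => ∃ i ∈ I', E i j).erase i₀ ⊆ I.biUnion t := by
      intro j hj
      obtain ⟨hj0, hj⟩ := Finset.mem_erase.1 hj
      obtain ⟨-, i, hi, hij⟩ := Finset.mem_filter.1 hj
      obtain ⟨i', hi', rfl⟩ := Finset.mem_image.1 hi
      exact Finset.mem_biUnion.2 ⟨i', hi', Finset.mem_filter.2 ⟨Finset.mem_univ _, hij, hj0⟩⟩
    have h4 := Finset.card_le_card h3
    have h5 := Finset.pred_card_le_card_erase (s := Finset.univ.filter fun j => ∃ i ∈ I', E i j)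
      (a := i₀)
    omega
  obtain ⟨f, hf, hft⟩ := (Finset.all_card_le_biUnion_card_iff_exists_injective t).1 hall
  have hft' : ∀ i : {i : Fin K // i ≠ i₀}, E i (f i) ∧ f i ≠ i₀ := fun i => (Finset.mem_filter.1 (hft i)).2
  let g : {i : Fin K // i ≠ i₀} → {i : Fin K // i ≠ i₀} := fun i => ⟨f i, (hft' i).2⟩
  have hg : Function.Bijective g := Finite.injective_iff_bijective.1 fun i j h =>
    hf (congrArg Subtype.val h)
  -- The matching permutes the indices other than i₀, so summing the edge inequalities counts each
  -- such b twice.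
  have hs : ∑ i : {i : Fin K // i ≠ i₀}, b (f i) = ∑ i : {i : Fin K // i ≠ i₀}, b i :=
    (Equiv.ofBijective g hg).sum_comp fun i : {i : Fin K // i ≠ i₀} => b i
  have hle : ∑ i : {i : Fin K // i ≠ i₀}, (b i + b (f i)) ≤ 0 :=
    Finset.sum_nonpos fun i _ => hb _ _ (hft' i).1
  rw [Finset.sum_add_distrib, hs] at hle
  have hsplit : ∑ i, b i = b i₀ + ∑ i : {i : Fin K // i ≠ i₀}, b i := by
    rw [← Finset.add_sum_erase _ _ (Finset.mem_univ i₀)]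
    congr 1
    rw [← Finset.sum_subtype (Finset.univ.erase i₀) (by simp) b]
  linarith

end Expanding

/-! ### Kernels with a block structure -/

/-- A kernel that is bounded below by `φ` on the blocks, of a partition into `K` parts of equal
mass, that are selected by an expanding relation. -/
structure IsBlocked (π : Measure X) (k : X → X → ℝ) (φ : ℝ) {K : ℕ} (E : Fin K → Fin K → Prop)
    (P : Fin K → Set X) : Prop where
  expanding : Expanding E
  meas : ∀ i, MeasurableSet (P i)
  disj : Pairwise fun i j => Disjoint (P i) (P j)
  cover : (⋃ i, P i) = Set.univ
  mass : ∀ i, π.real (P i) = 1 / K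
  le : ∀ i j, E i j → ∀ x ∈ P i, ∀ y ∈ P j, φ ≤ k x y

theorem B1.exists_isBlocked {π : Measure X} {k : X → X → ℝ} {φ : ℝ} {K : ℕ} (h : B1 π k φ K) :
    ∃ (E : Fin K → Fin K → Prop) (P : Fin K → Set X), IsBlocked π k φ E P := by
  obtain ⟨Z, P, ⟨-, hZ⟩, h01, hm, hd, hc, hmass, hle⟩ := h
  refine ⟨fun i j => Z i j ≠ 0, P, hZ, hm, hd, hc, fun i => ?_, fun i j hij x hx y hy => ?_⟩
  · simp [Measure.real, hmass]
  · have := hle i j x hx y hy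
    rwa [(h01 i j).resolve_left hij, mul_one] at this

section IsBlocked

variable {π : Measure X} {k : X → X → ℝ} {φ s : ℝ} {K : ℕ} {E : Fin K → Fin K → Prop}
  {P : Fin K → Set X}

theorem IsBlocked.exists_mem (hb : IsBlocked π k φ E P) (x : X) : ∃ i, x ∈ P i :=
  Set.mem_iUnion.1 (hb.cover ▸ Set.mem_univ x)

theorem IsBlocked.pos [IsProbabilityMeasure π] (hb : IsBlocked π k φ E P) : 0 < K := by
  obtain ⟨x⟩ : Nonempty X := π.nonempty_of_neZero
  obtain ⟨i, -⟩ := hb.exists_mem x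
  exact i.pos

theorem IsBlocked.sum_integral (hb : IsBlocked π k φ E P) {f : X → ℝ} (hf : Integrable f π) :
    ∑ i, ∫ x in P i, f x ∂π = ∫ x, f x ∂π := by
  rw [← integral_iUnion_fintype hb.meas hb.disj (fun i => hf.integrableOn), hb.cover,
    setIntegral_univ]

theorem IsBlocked.le_integral [IsFiniteMeasure π] (hb : IsBlocked π k φ E P) (hk : IsKernel π k s)
    {p : X → ℝ} (hp : IsBM p) (hp0 : ∀ y, 0 ≤ p y) {i j : Fin K} (hij : E i j) {x : X}
    (hx : x ∈ P i) : φ * ∫ y in P j, p y ∂π ≤ ∫ y, k x y * p y ∂π := by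
  rw [← integral_const_mul]
  refine (setIntegral_mono_on (hp.integrable.const_mul φ).integrableOn
    (hk.integrable_mul hp x).integrableOn (hb.meas j) fun y hy =>
      mul_le_mul_of_nonneg_right (hb.le i j hij x hx y hy) (hp0 y)).trans ?_
  exact setIntegral_le_integral (hk.integrable_mul hp x)
    (ae_of_all _ fun y => mul_nonneg (hk.nonneg x y) (hp0 y))

theorem IsBlocked.le_setIntegral [IsFiniteMeasure π] (hb : IsBlocked π k φ E P) {f : X → ℝ}
    (hf : IsBM f) {c : ℝ} {i : Fin K} (h : ∀ x ∈ P i, c ≤ f x) :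
    c / K ≤ ∫ x in P i, f x ∂π := by
  refine le_trans (le_of_eq ?_) (setIntegral_mono_on (integrable_const c).integrableOn
    hf.integrable.integrableOn (hb.meas i) h)
  rw [setIntegral_const, hb.mass, smul_eq_mul]
  ring

theorem IsBlocked.setIntegral_le [IsFiniteMeasure π] (hb : IsBlocked π k φ E P) {f : X → ℝ}
    (hf : IsBM f) {c : ℝ} {i : Fin K} (h : ∀ x ∈ P i, f x ≤ c) :
    ∫ x in P i, f x ∂π ≤ c / K := by
  refine (setIntegral_mono_on hf.integrable.integrableOn (integrable_const c).integrableOn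
    (hb.meas i) h).trans (le_of_eq ?_)
  rw [setIntegral_const, hb.mass, smul_eq_mul]
  ring

end IsBlocked

/-! ### Two-sided bounds on the imaginary axis -/

section ImaginaryAxis

variable {π : Measure X} {k : X → X → ℝ} {φ s t : ℝ} {K : ℕ} {E : Fin K → Fin K → Prop}
  {P : Fin K → Set X} {v : X → ℝ}

theorem IsBM.log {c : ℝ} (hv : IsBM v) (hc : 0 < c) (hcv : ∀ x, c ≤ v x) :
    IsBM fun x => Real.log (v x) := by
  -- |log v| ≤ v + 1/v.
  obtain ⟨C, hC⟩ := (hv.add (hv.inv_of_le hc hcv)).bdd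
  refine ⟨hv.meas.log, C, fun x => ?_⟩
  have hx := hc.trans_le (hcv x)
  have h1 := Real.log_le_sub_one_of_pos hx
  have h2 := Real.log_le_sub_one_of_pos (inv_pos.2 hx)
  rw [Real.log_inv] at h2
  have h3 := (le_abs_self _).trans (hC x)
  have h4 := inv_pos.2 hx
  rw [Real.norm_eq_abs, abs_le]
  constructor <;> linarith

/-- Lower bound on the mean of `log v`, from the convexity of the exponential function. -/
theorem integral_log_ge [IsProbabilityMeasure π] (hk : IsKernel π k s) (ht : 0 ≤ t)
    (hv : IsBM v) {c : ℝ} (hc : 0 < c) (hcv : ∀ x, c ≤ v x)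
    (heq : ∀ x, t * v x + v x * ∫ y, k x y * v y ∂π = 1) :
    (1 - 2 * t - s) / 2 ≤ ∫ x, Real.log (v x) ∂π := by
  set w : X → ℝ := fun x => Real.log (v x) with hw
  have hwb : IsBM w := hv.log hc hcv
  have hvw : IsBM fun x => v x * w x := hv.mul hwb
  have hpos : ∀ x, 0 < v x := fun x => hc.trans_le (hcv x)
  -- With w = log v, this is exp(-(w_x + w_y)) ≥ 1 - w_x - w_y multiplied by v_x v_y. Integrated
  -- against k, the equation and symmetry turn it into ∫ (1 - 2w)(1 - t v) ≤ s.
  have hpt : ∀ x y, v x * (1 - w x) * v y - v x * (v y * w y) ≤ 1 := fun x y => by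
    have h := Real.add_one_le_exp (-(w x + w y))
    have e : v x * v y * Real.exp (-(w x + w y)) = 1 := by
      rw [Real.exp_neg, Real.exp_add, hw, Real.exp_log (hpos x), Real.exp_log (hpos y)]
      exact mul_inv_cancel₀ (mul_pos (hpos x) (hpos y)).ne'
    have := mul_le_mul_of_nonneg_left h (mul_pos (hpos x) (hpos y)).le
    rw [e] at this
    linarith
  have hrow : ∀ x, (1 - w x) * (1 - t * v x) - v x * ∫ y, k x y * (v y * w y) ∂π ≤ s := fun x => by
    have h1 := hk.integral_le ((((IsBM.const (v x * (1 - w x))).mul hv).add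
      ((IsBM.const (v x)).mul hvw).neg)) zero_le_one
      (fun y => by simpa [sub_eq_add_neg] using hpt x y) x
    have e : ∫ y, k x y * (v x * (1 - w x) * v y + -(v x * (v y * w y))) ∂π
        = v x * (1 - w x) * (∫ y, k x y * v y ∂π) - v x * ∫ y, k x y * (v y * w y) ∂π := by
      rw [← integral_const_mul, ← integral_const_mul,
        ← integral_sub ((hk.integrable_mul hv x).const_mul _)
        ((hk.integrable_mul hvw x).const_mul _)]
      congr with y; ring
    rw [e] at h1
    have := heq x
    have e2 : v x * (1 - w x) * (∫ y, k x y * v y ∂π) = (1 - w x) * (1 - t * v x) := by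
      rw [← this]; ring
    rw [e2] at h1
    linarith
  have hA : IsBM fun x => (1 + -w x) * (1 + -(t * v x)) :=
    ((IsBM.const 1).add hwb.neg).mul ((IsBM.const 1).add ((IsBM.const t).mul hv).neg)
  have hB : IsBM fun x => v x * ∫ y, k x y * (v y * w y) ∂π := hv.mul (hk.isBM_integral hvw)
  have h2 : ∫ x, ((1 + -w x) * (1 + -(t * v x)) - v x * ∫ y, k x y * (v y * w y) ∂π) ∂π ≤ s := by
    refine (integral_mono (hA.integrable.sub hB.integrable) (integrable_const s) fun x => ?_).trans
      (by simp)
    simpa [sub_eq_add_neg] using hrow x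
  rw [integral_sub hA.integrable hB.integrable, hk.integral_swap hv hvw] at h2
  have hC : IsBM fun x => v x * w x * ∫ y, k x y * v y ∂π := hvw.mul (hk.isBM_integral hv)
  rw [← integral_sub hA.integrable hC.integrable] at h2
  have h3 : ∫ x, (1 - 2 * t + -(2 * w x)) ∂π ≤ s := by
    refine (integral_mono ((IsBM.const (1 - 2 * t)).add ((IsBM.const 2).mul hwb).neg).integrable
      (hA.integrable.sub hC.integrable) fun x => ?_).trans h2
    have e : v x * w x * ∫ y, k x y * v y ∂π = w x * (1 - t * v x) := by
      rw [← heq x]; ring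
    -- This absorbs the cross term 2 t v w; the surplus t v is non-negative.
    have hl : v x - 1 ≤ v x * w x := by
      have := Real.log_le_sub_one_of_pos (inv_pos.2 (hpos x))
      rw [Real.log_inv] at this
      have := mul_le_mul_of_nonneg_left this (hpos x).le
      rw [mul_sub, mul_inv_cancel₀ (hpos x).ne'] at this
      simp only [hw]
      linarith
    have h5 := mul_le_mul_of_nonneg_left hl ht
    have h6 := mul_nonneg ht (hpos x).le
    change _ ≤ (1 + -w x) * (1 + -(t * v x)) - v x * w x * ∫ y, k x y * v y ∂π
    rw [e]
    linarith
  have h4 : ∫ x, (1 - 2 * t + -(2 * w x)) ∂π = (1 - 2 * t) + -(2 * ∫ x, w x ∂π) := by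
    rw [integral_add (integrable_const _) ((IsBM.const 2).mul hwb).neg.integrable, integral_neg,
      integral_const_mul]
    simp
  linarith

/-- Lower bound on the block integrals of `v`. -/
theorem IsBlocked.exp_le_setIntegral [IsProbabilityMeasure π] (hb : IsBlocked π k φ E P)
    (hφ : 0 < φ) (hk : IsKernel π k s) (ht : 0 ≤ t) (ht1 : t ≤ 1)
    (hv : IsBM v) {c : ℝ} (hc : 0 < c) (hcv : ∀ x, c ≤ v x)
    (heq : ∀ x, t * v x + v x * ∫ y, k x y * v y ∂π = 1) (i : Fin K) :
    Real.exp (Real.log (K / φ) / 2 + K * (-1 - s - Real.log (K / φ)) / 2) / K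
      ≤ ∫ x in P i, v x ∂π := by
  have hK : (0 : ℝ) < K := by exact_mod_cast hb.pos
  have hpos : ∀ x, 0 < v x := fun x => hc.trans_le (hcv x)
  set a : Fin K → ℝ := fun i => ∫ x in P i, v x ∂π with ha
  have ha0 : ∀ i, 0 < a i := fun i =>
    (div_pos hc hK).trans_le (hb.le_setIntegral hv fun x _ => hcv x)
  have hlog := integral_log_ge hk ht hv hc hcv heq
  have hwb := hv.log hc hcv
  rw [← hb.sum_integral hwb.integrable] at hlog
  -- Jensen's inequality on a block, through the tangent of log at the block average K a_i.
  have hJ : ∀ i, ∫ x in P i, Real.log (v x) ∂π ≤ Real.log (K * a i) / K := fun i => by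
    have hKa : 0 < K * a i := mul_pos hK (ha0 i)
    have hg : IsBM fun x => Real.log (K * a i) - 1 + (K * a i)⁻¹ * v x :=
      (IsBM.const _).add ((IsBM.const _).mul hv)
    refine (setIntegral_mono_on hwb.integrable.integrableOn hg.integrable.integrableOn
      (hb.meas i) fun x _ => ?_).trans (le_of_eq ?_)
    · have h := Real.log_le_sub_one_of_pos (mul_pos (inv_pos.2 hKa) (hpos x))
      rw [Real.log_mul (inv_pos.2 hKa).ne' (hpos x).ne', Real.log_inv] at h
      linarith
    · rw [integral_add (integrable_const _) (((IsBM.const _).mul hv).integrable.integrableOn),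
        integral_const_mul, setIntegral_const, hb.mass, smul_eq_mul]
      change _ + (K * a i)⁻¹ * a i = _
      have := (ha0 i).ne'
      field_simp
      ring
  have hsum : K * ((1 - 2 * t - s) / 2) ≤ ∑ i, Real.log (K * a i) := by
    have h1 := hlog.trans (Finset.sum_le_sum fun i _ => hJ i)
    rw [← Finset.sum_div, le_div_iff₀ hK] at h1
    linarith
  have hedge : ∀ i j, E i j → Real.log (K * a i) + Real.log (K * a j) ≤ Real.log (K / φ) := by
    intro i j hij
    -- On P i the equation gives φ a_j v ≤ v S v ≤ 1; integration over a block of mass 1/K follows.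
    have h1 : φ * a j * a i ≤ 1 / K := by
      have : ∀ x ∈ P i, φ * a j * v x ≤ 1 := fun x hx => by
        have h2 := hb.le_integral hk hv (fun y => (hpos y).le) hij hx
        have h3 := mul_le_mul_of_nonneg_right h2 (hpos x).le
        have h4 := mul_nonneg ht (hpos x).le
        have h5 := heq x
        simp only [ha]
        linarith
      have h2 := hb.setIntegral_le ((IsBM.const (φ * a j)).mul hv) this
      rwa [integral_const_mul] at h2
    rw [← Real.log_mul (mul_pos hK (ha0 i)).ne' (mul_pos hK (ha0 j)).ne']
    refine Real.log_le_log (mul_pos (mul_pos hK (ha0 i)) (mul_pos hK (ha0 j))) ?_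
    rw [le_div_iff₀ hφ]
    rw [le_div_iff₀ hK] at h1
    nlinarith
  -- Subtracting half of log(K/φ) from each potential makes every edge sum non-positive.
  have hmain := hb.expanding.sum_le (b := fun i => Real.log (K * a i) - Real.log (K / φ) / 2)
    (fun i j hij => by have := hedge i j hij; linarith) i
  rw [Finset.sum_sub_distrib, Finset.sum_const, Finset.card_univ, Fintype.card_fin,
    nsmul_eq_mul] at hmain
  have hfin : Real.log (K / φ) / 2 + K * (-1 - s - Real.log (K / φ)) / 2
      ≤ Real.log (K * a i) := by
    have := mul_le_mul_of_nonneg_left ht1 hK.le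
    nlinarith
  rw [Real.le_log_iff_exp_le (mul_pos hK (ha0 i))] at hfin
  rw [div_le_iff₀ hK]
  exact hfin.trans_eq (mul_comm _ _)

end ImaginaryAxis

/-- Two-sided bounds, in terms of `φ`, `K` and `s` only, on the solution of `1 / v = t + S v`. -/
theorem exists_bounds (K : ℕ) {φ s : ℝ} (hφ : 0 < φ) (hs : 0 < s) (hK : 0 < K) :
    ∃ c V : ℝ, 0 < c ∧ 0 < V ∧ ∀ (X : Type u) [MeasurableSpace X] (π : Measure X)
      [IsProbabilityMeasure π] (k : X → X → ℝ) (E : Fin K → Fin K → Prop) (P : Fin K → Set X)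
      (t : ℝ) (v : X → ℝ), IsKernel π k s → IsBlocked π k φ E P → 0 ≤ t → t ≤ 1 → IsBM v →
      (∃ c', 0 < c' ∧ ∀ x, c' ≤ v x) → (∀ x, t * v x + v x * ∫ y, k x y * v y ∂π = 1) →
      ∀ x, c ≤ v x ∧ v x ≤ V := by
  have hK' : (0 : ℝ) < K := by exact_mod_cast hK
  set a := Real.exp (Real.log (K / φ) / 2 + K * (-1 - s - Real.log (K / φ)) / 2) / K with ha
  have ha0 : 0 < a := div_pos (Real.exp_pos _) hK'
  -- Upper bound: v φ a ≤ v S v ≤ 1 for a block adjacent to that of x. Lower bound: 1 = v (t + S v)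
  -- ≤ v (1 + s V).
  refine ⟨1 / (1 + s * (1 / (φ * a))), 1 / (φ * a), by positivity, by positivity, ?_⟩
  intro X _ π _ k E P t v hk hb ht ht1 hv ⟨c', hc', hcv⟩ heq x
  have hpos : ∀ x, 0 < v x := fun x => hc'.trans_le (hcv x)
  have hup : ∀ x, v x ≤ 1 / (φ * a) := fun x => by
    obtain ⟨i, hi⟩ := hb.exists_mem x
    obtain ⟨j, hij⟩ := hb.expanding.exists_right i
    have h1 := hb.le_integral hk hv (fun y => (hpos y).le) hij hi
    have h2 := hb.exp_le_setIntegral hφ hk ht ht1 hv hc' hcv heq j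
    have h3 := (mul_le_mul_of_nonneg_left h2 hφ.le).trans h1
    have h4 := mul_le_mul_of_nonneg_left h3 (hpos x).le
    rw [le_div_iff₀ (by positivity)]
    have h5 := heq x
    have h6 := mul_nonneg ht (hpos x).le
    linarith
  refine ⟨?_, hup x⟩
  have h1 := hk.integral_le hv (by positivity) hup x
  rw [div_le_iff₀ (by positivity)]
  have h0 := heq x
  have h2 := mul_le_mul_of_nonneg_left h1 (hpos x).le
  have h3 := mul_le_mul_of_nonneg_right ht1 (hpos x).le
  linarith

/-! ### Invertibility of 1 + F in the supremum norm -/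

/-- The integral operator with kernel `F` on real functions. -/
noncomputable def kerOp (π : Measure X) (F : X → X → ℝ) (f : X → ℝ) : X → ℝ :=
  fun x => ∫ y, F x y * f y ∂π

section KerOp

variable {π : Measure X} {F : X → X → ℝ} {κ : ℝ} {K : ℕ}
  {E : Fin K → Fin K → Prop} {P : Fin K → Set X}

theorem IsKernel.iterate_nonneg (hF : IsKernel π F 1) {f : X → ℝ} (hf : ∀ x, 0 ≤ f x) (n : ℕ) :
    ∀ x, 0 ≤ (kerOp π F)^[n] f x := by
  induction n with
  | zero => exact hf
  | succ n ih =>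
    rw [Function.iterate_succ_apply']
    exact hF.integral_nonneg ih

theorem iterate_kerOp_neg (f : X → ℝ) (n : ℕ) : (kerOp π F)^[n] (fun x => -f x)
      = fun x => -(kerOp π F)^[n] f x := by
  induction n with
  | zero => rfl
  | succ n ih =>
    simp only [Function.iterate_succ_apply', ih]
    ext x
    rw [kerOp, kerOp, ← integral_neg]
    simp_rw [mul_neg]

variable [IsProbabilityMeasure π]

theorem IsKernel.isBM_iterate (hF : IsKernel π F 1) {f : X → ℝ} (hf : IsBM f) (n : ℕ) :
    IsBM ((kerOp π F)^[n] f) := by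
  induction n with
  | zero => exact hf
  | succ n ih =>
    rw [Function.iterate_succ_apply']
    exact hF.isBM_integral ih

theorem IsKernel.iterate_const_le (hF : IsKernel π F 1) {M : ℝ} (hM : 0 ≤ M) (n : ℕ) :
    ∀ x, (kerOp π F)^[n] (fun _ => M) x ≤ M := by
  induction n with
  | zero => exact fun _ => le_rfl
  | succ n ih =>
    intro x
    rw [Function.iterate_succ_apply']
    exact (hF.integral_le (hF.isBM_iterate (IsBM.const M) n) hM ih x).trans_eq (one_mul M)

theorem IsKernel.iterate_add (hF : IsKernel π F 1) {f g : X → ℝ} (hf : IsBM f) (hg : IsBM g)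
    (n : ℕ) : (kerOp π F)^[n] (fun x => f x + g x)
      = fun x => (kerOp π F)^[n] f x + (kerOp π F)^[n] g x := by
  induction n with
  | zero => rfl
  | succ n ih =>
    simp only [Function.iterate_succ_apply', ih]
    ext x
    rw [kerOp, kerOp, kerOp, ← integral_add (hF.integrable_mul (hF.isBM_iterate hf n) x)
      (hF.integrable_mul (hF.isBM_iterate hg n) x)]
    simp_rw [mul_add]

open Classical in
/-- Mass of the iterates spreads over one more block at each step. -/
theorem IsBlocked.exists_blocks (hb : IsBlocked π F κ E P) (hκ : 0 < κ) (hF : IsKernel π F 1)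
    {p : X → ℝ} (hp : IsBM p) (hp0 : ∀ x, 0 ≤ p x) (n : ℕ) :
    ∃ J : Finset (Fin K), J.Nonempty ∧ min (n + 1) K ≤ J.card ∧
      ∀ j ∈ J, (κ / K) ^ n * ((∫ x, p x ∂π) / K) ≤ ∫ x in P j, (kerOp π F)^[n] p x ∂π := by
  have hK : (0 : ℝ) < K := by exact_mod_cast hb.pos
  induction n with
  | zero =>
    have : ∃ j ∈ Finset.univ, (∫ x, p x ∂π) / K ≤ ∫ x in P j, p x ∂π := by
      have : Nonempty (Fin K) := ⟨⟨0, hb.pos⟩⟩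
      refine Finset.exists_le_of_sum_le Finset.univ_nonempty ?_
      rw [hb.sum_integral hp.integrable, Finset.sum_const, Finset.card_univ, Fintype.card_fin,
        nsmul_eq_mul]
      exact (mul_div_cancel₀ _ hK.ne').le
    obtain ⟨j, -, hj⟩ := this
    exact ⟨{j}, by simp, by simp, by simpa using hj⟩
  | succ n ih =>
    obtain ⟨J, hJ, hc, hle⟩ := ih
    -- Mass on block j reaches every block i with an edge from i to j, so the transposed relation
    -- governs the spreading.
    have hcard := hb.expanding.flip.card_image hJ
    refine ⟨Finset.univ.filter fun i => ∃ j ∈ J, E i j, ?_, by omega, fun i hi => ?_⟩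
    · rw [← Finset.card_pos]
      have := hb.pos
      omega
    · obtain ⟨-, j, hj, hij⟩ := Finset.mem_filter.1 hi
      rw [Function.iterate_succ_apply']
      have h1 := hb.le_setIntegral (hF.isBM_integral (hF.isBM_iterate hp n)) (fun x hx =>
        (mul_le_mul_of_nonneg_left (hle j hj) hκ.le).trans
          (hb.le_integral hF (hF.isBM_iterate hp n) (hF.iterate_nonneg hp0 n) hij hx))
      refine le_trans (le_of_eq ?_) h1
      rw [pow_succ]
      ring

/-- After `2 K + 1` steps the iterates are bounded below by a multiple of the mean. -/
theorem IsBlocked.le_iterate (hb : IsBlocked π F κ E P) (hκ : 0 < κ) (hF : IsKernel π F 1)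
    {p : X → ℝ} (hp : IsBM p) (hp0 : ∀ x, 0 ≤ p x) (x : X) :
    (κ / K) ^ (2 * K + 1) * ∫ x, p x ∂π ≤ (kerOp π F)^[2 * K + 1] p x := by
  obtain ⟨J, -, hc, hle⟩ := hb.exists_blocks hκ hF hp hp0 (2 * K)
  have hJ : J = Finset.univ := by
    rw [← Finset.card_eq_iff_eq_univ, Fintype.card_fin]
    have := J.card_le_univ
    rw [Fintype.card_fin] at this
    omega
  obtain ⟨i, hi⟩ := hb.exists_mem x
  obtain ⟨j, hij⟩ := hb.expanding.exists_right i
  rw [Function.iterate_succ_apply']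
  refine le_trans (le_of_eq ?_) ((mul_le_mul_of_nonneg_left (hle j (by simp [hJ])) hκ.le).trans
    (hb.le_integral hF (hF.isBM_iterate hp _) (hF.iterate_nonneg hp0 _) hij hi))
  rw [pow_succ]
  ring

/-- The lower bound of `le_iterate`, applied to the non-negative functions M - f and M + f,
contracts f up to its mean. -/
theorem IsBlocked.abs_iterate_le (hb : IsBlocked π F κ E P) (hκ : 0 < κ) (hF : IsKernel π F 1)
    {f : X → ℝ} (hf : IsBM f) {M : ℝ} (hM : ∀ x, |f x| ≤ M) (x : X) :
    |(kerOp π F)^[2 * K + 1] f x|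
      ≤ (1 - (κ / K) ^ (2 * K + 1)) * M + (κ / K) ^ (2 * K + 1) * |∫ x, f x ∂π| := by
  have hM0 : 0 ≤ M := (abs_nonneg _).trans (hM x)
  have hε : 0 ≤ (κ / K) ^ (2 * K + 1) := by positivity
  have hside : ∀ {g : X → ℝ}, IsBM g → (∀ x, |g x| ≤ M) → (kerOp π F)^[2 * K + 1] g x
      ≤ (1 - (κ / K) ^ (2 * K + 1)) * M + (κ / K) ^ (2 * K + 1) * |∫ x, g x ∂π| := by
    intro g hg hgM
    have h1 := hb.le_iterate hκ hF ((IsBM.const M).add hg.neg) (fun y => by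
      have := (le_abs_self _).trans (hgM y)
      linarith) x
    rw [hF.iterate_add (IsBM.const M) hg.neg, iterate_kerOp_neg,
      integral_add (integrable_const _) hg.neg.integrable, integral_neg] at h1
    have h2 := hF.iterate_const_le hM0 (2 * K + 1) x
    have h3 := mul_le_mul_of_nonneg_left (le_abs_self (∫ x, g x ∂π)) hε
    simp only [integral_const, probReal_univ, one_smul] at h1
    linarith
  have h1 := hside hf hM
  have h2 := hside hf.neg (fun y => by rw [abs_neg]; exact hM y)
  rw [iterate_kerOp_neg, integral_neg, abs_neg] at h2
  exact abs_le.2 ⟨by linarith, h1⟩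

/-- `1 + F` is bounded below in the supremum norm. -/
theorem IsBlocked.abs_le_of_add_kerOp (hb : IsBlocked π F κ E P) (hκ : 0 < κ)
    (hF : IsKernel π F 1) {f : X → ℝ} (hf : IsBM f) {η : ℝ}
    (h : ∀ x, |f x + kerOp π F f x| ≤ η) (x : X) :
    |f x| ≤ (2 * (2 * K + 1) / (κ / K) ^ (2 * K + 1) + 1) * η := by
  have hη : 0 ≤ η := (abs_nonneg _).trans (h x)
  have hK : (0 : ℝ) < K := by exact_mod_cast hb.pos
  set ε := (κ / K) ^ (2 * K + 1) with hε
  have hε0 : 0 < ε := by positivity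
  set T := kerOp π F with hT
  have hsucc : ∀ n x, |T^[n] f x + T^[n + 1] f x| ≤ η := fun n => by
    induction n with
    | zero => exact h
    | succ n ih =>
      intro x
      have hbm := (hF.isBM_iterate hf n).add (hF.isBM_iterate hf (n + 1))
      have e : T^[n + 1] f x + T^[n + 1 + 1] f x
          = ∫ y, F x y * (T^[n] f y + T^[n + 1] f y) ∂π := by
        rw [Function.iterate_succ_apply' T n, Function.iterate_succ_apply' T (n + 1), hT, kerOp,
          kerOp, ← integral_add (hF.integrable_mul (hF.isBM_iterate hf n) x)
          (hF.integrable_mul (hF.isBM_iterate hf (n + 1)) x)]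
        simp_rw [mul_add, Function.iterate_succ_apply']
      rw [e, abs_le]
      have h1 := hF.integral_le hbm hη (fun y => (le_abs_self _).trans (ih y)) x
      have h2 := hF.integral_le hbm.neg hη (fun y => (neg_le_abs _).trans (ih y)) x
      simp only [mul_neg, integral_neg] at h2
      constructor <;> linarith
  -- Telescoping of f - (-F)ⁿ f; each of the n terms is at most η.
  have htel : ∀ n x, |f x - (-1) ^ n * T^[n] f x| ≤ n * η := fun n => by
    induction n with
    | zero => simp
    | succ n ih =>
      intro x
      have e : f x - (-1) ^ (n + 1) * T^[n + 1] f x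
          = (f x - (-1) ^ n * T^[n] f x) + (-1) ^ n * (T^[n] f x + T^[n + 1] f x) := by
        rw [pow_succ]; ring
      rw [e]
      refine (abs_add_le _ _).trans ?_
      rw [abs_mul, abs_pow, abs_neg, abs_one, one_pow, one_mul]
      push_cast
      linarith [ih x, hsucc n x]
  set M := ⨆ x, |f x| with hM
  have hbdd : BddAbove (Set.range fun x => |f x|) := by
    obtain ⟨C, hC⟩ := hf.bdd
    exact ⟨C, by rintro _ ⟨y, rfl⟩; exact hC y⟩
  have hfM : ∀ y, |f y| ≤ M := fun y => le_ciSup hbdd y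
  have hM0 : 0 ≤ M := (abs_nonneg _).trans (hfM x)
  -- By symmetry ∫ F f = ∫ f · F1, so 2∫f = ∫ (f + F f) + ∫ f (1 - F1), where 0 ≤ 1 - F1 ≤ 1. The
  -- factor 1/2 is what excludes an approximate eigenvalue -1.
  have hmean : |∫ y, f y ∂π| ≤ (η + M) / 2 := by
    have hTf : IsBM (T f) := hF.isBM_integral hf
    have hsw := hF.integral_swap (IsBM.const 1) hf
    simp only [one_mul, mul_one] at hsw
    have hrow : ∀ y, 0 ≤ ∫ u, F y u ∂π := fun y => MeasureTheory.integral_nonneg (hF.nonneg y)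
    have hrb : IsBM fun y => ∫ u, F y u ∂π := by
      simpa using hF.isBM_integral (IsBM.const 1)
    have hpt : ∀ y, |(f y + T f y) + (f y - f y * ∫ u, F y u ∂π)| ≤ η + M := fun y => by
      refine (abs_add_le _ _).trans (add_le_add (h y) ?_)
      have e : f y - f y * ∫ u, F y u ∂π = f y * (1 - ∫ u, F y u ∂π) := by ring
      rw [e, abs_mul]
      refine (mul_le_of_le_one_right (abs_nonneg _) ?_).trans (hfM y)
      rw [abs_le]
      constructor <;> linarith [hrow y, hF.le y]
    have hI : ∫ y, ((f y + T f y) + (f y + -(f y * ∫ u, F y u ∂π))) ∂π = 2 * ∫ y, f y ∂π := by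
      rw [integral_add (hf.add hTf).integrable (hf.add (hf.mul hrb).neg).integrable,
        integral_add hf.integrable hTf.integrable,
        integral_add hf.integrable (hf.mul hrb).neg.integrable, integral_neg, ← hsw]
      change _ + ∫ y, T f y ∂π + (_ + -∫ y, T f y ∂π) = _
      ring
    have hn := norm_integral_le_of_norm_le_const (μ := π)
      (f := fun y => (f y + T f y) + (f y - f y * ∫ u, F y u ∂π)) (ae_of_all π hpt)
    simp only [sub_eq_add_neg] at hn
    rw [hI, probReal_univ, mul_one, Real.norm_eq_abs, abs_mul, abs_two] at hn
    linarith
  have hle : M ≤ (2 * K + 1) * η + ((1 - ε) * M + ε * ((η + M) / 2)) := by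
    have : Nonempty X := ⟨x⟩
    refine ciSup_le fun y => ?_
    have h1 := htel (2 * K + 1) y
    rw [Odd.neg_one_pow ⟨K, rfl⟩] at h1
    have h2 := hb.abs_iterate_le hκ hF hf hfM y
    have h3 := mul_le_mul_of_nonneg_left hmean hε0.le
    have h4 : |f y| ≤ |f y - -1 * T^[2 * K + 1] f y| + |T^[2 * K + 1] f y| := by
      have := abs_sub (f y - -1 * T^[2 * K + 1] f y) (T^[2 * K + 1] f y)
      rwa [show f y - -1 * T^[2 * K + 1] f y - T^[2 * K + 1] f y = f y by ring] at this
    push_cast at h1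
    linarith
  refine (hfM x).trans ?_
  have h1 : ε * M ≤ (2 * (2 * K + 1) + ε) * η := by linarith
  rw [div_add_one hε0.ne', div_mul_eq_mul_div, le_div_iff₀ hε0]
  linarith

end KerOp

/-! ### Perturbation around a point of the imaginary axis -/

section Perturbation

variable {π : Measure X} {k : X → X → ℝ} {φ s : ℝ} {K : ℕ}
  {E : Fin K → Fin K → Prop} {P : Fin K → Set X}

/-- The kernel `v_x k_xy v_y`. -/
theorem IsKernel.saturated (hk : IsKernel π k s) {v : X → ℝ} (hv : IsBM v) (hv0 : ∀ x, 0 ≤ v x)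
    (h1 : ∀ x, v x * ∫ y, k x y * v y ∂π ≤ 1) :
    IsKernel π (fun x y => v x * (k x y * v y)) 1 where
  meas := (hv.meas.comp measurable_fst).mul (hk.meas.mul (hv.meas.comp measurable_snd))
  symm x y := by simp only [hk.symm x y]; ring
  nonneg x y := mul_nonneg (hv0 x) (mul_nonneg (hk.nonneg x y) (hv0 y))
  int x := (hk.integrable_mul hv x).const_mul _
  le x := by
    rw [integral_const_mul]
    exact h1 x

theorem IsBlocked.saturated (hb : IsBlocked π k φ E P) (hφ : 0 ≤ φ) {v : X → ℝ} {c : ℝ}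
    (hc : 0 ≤ c) (hcv : ∀ x, c ≤ v x) :
    IsBlocked π (fun x y => v x * (k x y * v y)) (c * (φ * c)) E P where
  expanding := hb.expanding
  meas := hb.meas
  disj := hb.disj
  cover := hb.cover
  mass := hb.mass
  le i j hij x hx y hy := by
    have h := hb.le i j hij x hx y hy
    have hx0 := hc.trans (hcv x)
    have hk0 := hφ.trans h
    exact mul_le_mul (hcv x) (mul_le_mul h (hcv y) hc hk0) (mul_nonneg hφ hc) hx0

variable [IsProbabilityMeasure π]

/-- On the imaginary axis the imaginary part solves a real quadratic equation. -/
theorem IsSol.im_mul_eq (hk : IsKernel π k s) {t : ℝ} (ht : 0 < t) {m : X → ℂ}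
    (hm : IsSol π k (t * Complex.I) m) (x : X) :
    t * (m x).im + (m x).im * ∫ y, k x y * (m y).im ∂π = 1 := by
  have h := hm.im_eq hk x
  have hre := hm.re_eq_zero hk ht x
  have hn : ‖m x‖ ^ 2 = (m x).im ^ 2 := by
    rw [← Complex.normSq_eq_norm_sq, Complex.normSq_apply, hre]; ring
  have hp := hm.im_pos x
  have hz : ((t : ℂ) * Complex.I).im = t := by simp
  rw [hn, hz, div_eq_iff (by positivity)] at h
  have h2 : (m x).im * (t * (m x).im + (m x).im * ∫ y, k x y * (m y).im ∂π) = (m x).im * 1 := by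
    linarith
  exact mul_left_cancel₀ hp.ne' h2

theorem IsSol.eq_mul_I (hk : IsKernel π k s) {t : ℝ} (ht : 0 < t) {m : X → ℂ}
    (hm : IsSol π k (t * Complex.I) m) (x : X) : m x = (m x).im * Complex.I := by
  apply Complex.ext <;> simp [hm.re_eq_zero hk ht x]

/-- A perturbation that is not too large is small. -/
theorem IsBlocked.norm_le_of_norm_le (hb : IsBlocked π k φ E P) (hφ : 0 < φ)
    (hk : IsKernel π k s) {t : ℝ} (ht : 0 < t) {m₀ m : X → ℂ}
    (hm₀ : IsSol π k (t * Complex.I) m₀) {z : ℂ} (hm : IsSol π k z m) {c V : ℝ}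
    (hc : 0 < c) (hcV : ∀ x, c ≤ (m₀ x).im ∧ (m₀ x).im ≤ V) {C : ℝ} (hC1 : 1 ≤ C)
    (hC : 2 * (2 * K + 1) / (c * (φ * c) / K) ^ (2 * K + 1) + 1 ≤ C)
    (hsmall : ∀ x, ‖m x - m₀ x‖ ≤ 1 / (4 * C) * (m₀ x).im) (x : X) :
    ‖m x - m₀ x‖ ≤ 8 * C * V * ‖z - t * Complex.I‖ * (m₀ x).im := by
  set v : X → ℝ := fun x => (m₀ x).im with hv
  set ζ := z - t * Complex.I with hζ
  have hvb : IsBM v := hm₀.bm.im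
  have hvpos : ∀ x, 0 < v x := hm₀.im_pos
  have hV : 0 < V := (hvpos x).trans_le (hcV x).2
  set F : X → X → ℝ := fun x y => v x * (k x y * v y) with hFdef
  have hF : IsKernel π F 1 := hk.saturated hvb (fun x => (hvpos x).le) fun x => by
    have h := hm₀.im_mul_eq hk ht x
    have := mul_nonneg ht.le (hvpos x).le
    simp only [hv] at this ⊢
    linarith
  have hbF : IsBlocked π F (c * (φ * c)) E P := hb.saturated hφ.le hc.le fun x => (hcV x).1
  set A := 1 / (4 * C) with hA
  have hA0 : 0 < A := by positivity
  have hA1 : A ≤ 1 := by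
    rw [hA, div_le_one (by positivity)]; linarith
  set u : X → ℂ := fun x => (m x - m₀ x) / (v x : ℂ) with hu
  have hvu : ∀ x, m x - m₀ x = v x * u x := fun x => by
    have : (v x : ℂ) ≠ 0 := by exact_mod_cast (hvpos x).ne'
    simp only [hu]; field_simp
  have hnorm : ∀ x, ‖m x - m₀ x‖ = ‖u x‖ * v x := fun x => by
    rw [hvu, norm_mul, Complex.norm_real, Real.norm_of_nonneg (hvpos x).le, mul_comm]
  have huA : ∀ x, ‖u x‖ ≤ A := fun x => by
    have := hsmall x
    rw [hnorm] at this
    exact le_of_mul_le_mul_right this (hvpos x)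
  have hub : IsBM u := ⟨(hm.bm.meas.sub hm₀.bm.meas).div
    (Complex.measurable_ofReal.comp hvb.meas), A, huA⟩
  set N : ℝ := ⨆ x, ‖u x‖ with hN
  have hbdd : BddAbove (Set.range fun x => ‖u x‖) := ⟨A, by rintro _ ⟨y, rfl⟩; exact huA y⟩
  have huN : ∀ y, ‖u y‖ ≤ N := fun y => le_ciSup hbdd y
  have hN0 : 0 ≤ N := (norm_nonneg _).trans (huN x)
  have hFu : ∀ y, ‖∫ w, (F y w : ℂ) * u w ∂π‖ ≤ N := fun y =>
    (hF.norm_integral_le u y).trans ((hF.integral_le hub.norm hN0 huN y).trans_eq (one_mul N))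
  -- With m = v(i + u) and m₀ = iv, the difference of the equations is u = iv(i + u)(ζ + Q), where F
  -- u = v Q; the linear part of this is moved to the left.
  have heq : ∀ y, u y + ∫ w, (F y w : ℂ) * u w ∂π
      = v y * ζ * (Complex.I * u y - 1) + Complex.I * u y * ∫ w, (F y w : ℂ) * u w ∂π := by
    intro y
    have hvy : (v y : ℂ) ≠ 0 := by exact_mod_cast (hvpos y).ne'
    have hne : m y ≠ 0 := norm_pos_iff.1 (hm.norm_pos y)
    have hne₀ : m₀ y ≠ 0 := norm_pos_iff.1 (hm₀.norm_pos y)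
    have hm₀y : m₀ y = v y * Complex.I := hm₀.eq_mul_I hk ht y
    have hint : ∫ w, (F y w : ℂ) * u w ∂π
        = v y * (∫ w, (k y w : ℂ) * m w ∂π - ∫ w, (k y w : ℂ) * m₀ w ∂π) := by
      rw [← integral_sub (hk.integrable_mul_complex hm.bm y)
        (hk.integrable_mul_complex hm₀.bm y), ← integral_const_mul]
      congr with w
      rw [← mul_sub, hvu]
      simp only [hFdef]
      push_cast
      ring
    have hd : m y - m₀ y
        = m y * m₀ y * (ζ + (∫ w, (k y w : ℂ) * m w ∂π - ∫ w, (k y w : ℂ) * m₀ w ∂π)) := by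
      have e1 := hm.eq y
      have e2 := hm₀.eq y
      have e3 : ζ + (∫ w, (k y w : ℂ) * m w ∂π - ∫ w, (k y w : ℂ) * m₀ w ∂π)
          = 1 / m₀ y - 1 / m y := by
        rw [hζ]; linear_combination e2 - e1
      rw [e3]; field_simp
    have hmy : m y = v y * (Complex.I + u y) := by
      have := hvu y
      rw [hm₀y] at this
      linear_combination this
    set Q := ∫ w, (k y w : ℂ) * m w ∂π - ∫ w, (k y w : ℂ) * m₀ w ∂π with hQ
    rw [hint]
    rw [hvu y, hmy, hm₀y] at hd
    have hd' : u y = (Complex.I + u y) * (v y * Complex.I) * (ζ + Q) := by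
      apply mul_left_cancel₀ hvy
      linear_combination hd
    linear_combination hd' + v y * (ζ + Q) * Complex.I_mul_I
  have hbound : ∀ y, ‖u y + ∫ w, (F y w : ℂ) * u w ∂π‖ ≤ 2 * V * ‖ζ‖ + A * N := fun y => by
    rw [heq y]
    refine (norm_add_le _ _).trans (add_le_add ?_ ?_)
    · rw [norm_mul, norm_mul, Complex.norm_real, Real.norm_of_nonneg (hvpos y).le]
      have h1 : ‖Complex.I * u y - 1‖ ≤ 2 := by
        refine (norm_sub_le _ _).trans ?_
        rw [norm_mul, Complex.norm_I, one_mul, norm_one]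
        linarith [huA y]
      have h2 : v y * ‖ζ‖ ≤ V * ‖ζ‖ := mul_le_mul_of_nonneg_right (hcV y).2 (norm_nonneg _)
      calc v y * ‖ζ‖ * ‖Complex.I * u y - 1‖ ≤ V * ‖ζ‖ * 2 :=
            mul_le_mul h2 h1 (norm_nonneg _) (by positivity)
        _ = _ := by ring
    · rw [norm_mul, norm_mul, Complex.norm_I, one_mul]
      exact mul_le_mul (huA y) (hFu y) (norm_nonneg _) hA0.le
  set η := 2 * V * ‖ζ‖ + A * N with hη
  have hη0 : 0 ≤ η := by positivity
  have hre : ∀ y, |(u y).re| ≤ C * η := fun y => by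
    refine (hbF.abs_le_of_add_kerOp (by positivity) hF hub.re (η := η) (fun y => ?_) y).trans
      (mul_le_mul_of_nonneg_right hC hη0)
    rw [kerOp, ← hF.integral_re hub, ← Complex.add_re]
    exact (Complex.abs_re_le_norm _).trans (hbound y)
  have him : ∀ y, |(u y).im| ≤ C * η := fun y => by
    refine (hbF.abs_le_of_add_kerOp (by positivity) hF hub.im (η := η) (fun y => ?_) y).trans
      (mul_le_mul_of_nonneg_right hC hη0)
    rw [kerOp, ← hF.integral_im hub, ← Complex.add_im]
    exact (Complex.abs_im_le_norm _).trans (hbound y)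
  -- The inverse bound is for real functions, so real and imaginary parts each contribute C η.
  have hNle : N ≤ 2 * (C * η) := by
    have : Nonempty X := ⟨x⟩
    refine ciSup_le fun y => ?_
    linarith [Complex.norm_le_abs_re_add_abs_im (u y), hre y, him y]
  -- The choice of A makes the quadratic term contribute N/2, which is absorbed.
  have hCA : C * A = 1 / 4 := by rw [hA]; field_simp
  have hfin : N ≤ 8 * C * V * ‖ζ‖ := by
    have : C * η = 2 * C * V * ‖ζ‖ + C * A * N := by rw [hη]; ring
    rw [this, hCA] at hNle
    linarith
  rw [hnorm]
  exact mul_le_mul_of_nonneg_right ((huN x).trans hfin) (hvpos x).le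

end Perturbation

/-! ### The neighborhood of zero -/

/-- Boundedness of the solution in a neighborhood of zero. -/
theorem exists_bound_near_zero (K : ℕ) {φ s : ℝ} (hφ : 0 < φ) (hs : 0 < s) :
    ∃ δ Φ : ℝ, 0 < δ ∧ ∀ (X : Type u) [MeasurableSpace X] (π : Measure X)
      [IsProbabilityMeasure π] (k : X → X → ℝ) (m : UpperHalfPlane → BB X), IsKernel π k s →
      B1 π k φ K → (∀ z : UpperHalfPlane, IsSol π k z fun x => m z x) →
      ∀ z : UpperHalfPlane, ‖(z : ℂ)‖ ≤ δ → ‖m z‖ ≤ Φ := by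
  -- A probability space has no partition into zero parts, so any constants do.
  rcases Nat.eq_zero_or_pos K with rfl | hK
  · refine ⟨1, 0, one_pos, ?_⟩
    intro X _ π _ k m _ hB
    obtain ⟨E, P, hb⟩ := hB.exists_isBlocked
    exact absurd hb.pos (lt_irrefl 0)
  have hK' : (0 : ℝ) < K := by exact_mod_cast hK
  obtain ⟨c, V, hc, hV, hcV⟩ := exists_bounds.{u} K hφ hs hK
  set C : ℝ := 2 * (2 * K + 1) / (c * (φ * c) / K) ^ (2 * K + 1) + 1 with hC
  have hC1 : 1 ≤ C := by
    rw [hC]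
    have : 0 ≤ 2 * (2 * (K : ℝ) + 1) / (c * (φ * c) / K) ^ (2 * K + 1) := by positivity
    linarith
  have hC0 : 0 < C := one_pos.trans_le hC1
  -- B lies below the smallness threshold v/(4C), and δ makes 8CV · 2δ · V ≤ B/2, the factor 2δ
  -- bounding |w - iδ|. The bound δ ≤ 1 is needed for `exists_bounds`.
  set B := 1 / (4 * C) * c with hBdef
  have hB0 : 0 < B := by positivity
  set δ := min 1 (B / 2 / (16 * C * V * V)) with hδ
  have hδ0 : 0 < δ := by positivity
  refine ⟨δ, V + B, hδ0, ?_⟩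
  intro X _ π _ k m hk hB1 hsol z hz
  obtain ⟨E, P, hb⟩ := hB1.exists_isBlocked
  have hδim : 0 < ((δ : ℂ) * Complex.I).im := by simpa using hδ0
  set z₀ : UpperHalfPlane := ⟨(δ : ℂ) * Complex.I, hδim⟩ with hz₀
  have hm₀ : IsSol π k (δ * Complex.I) fun x => m z₀ x := hsol z₀
  have hvb : ∀ x, c ≤ (m z₀ x).im ∧ (m z₀ x).im ≤ V :=
    hcV X π k E P δ (fun x => (m z₀ x).im) hk hb hδ0.le (min_le_left _ _) hm₀.bm.im
      (hm₀.exists_le_im hk hδim) (hm₀.im_mul_eq hk hδ0)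
  have hgap : ∀ w : UpperHalfPlane, ‖(w : ℂ)‖ ≤ δ → ‖m w - m z₀‖ ≤ B →
      ‖m w - m z₀‖ ≤ B / 2 := by
    intro w hw hwB
    refine BB.norm_le _ (by positivity) fun x => ?_
    change ‖m w x - m z₀ x‖ ≤ _
    have hsmall : ∀ x, ‖m w x - m z₀ x‖ ≤ 1 / (4 * C) * (m z₀ x).im := fun x =>
      ((BB.norm_apply_le (m w - m z₀) x).trans hwB).trans
        (mul_le_mul_of_nonneg_left (hvb x).1 (by positivity))
    have h := hb.norm_le_of_norm_le hφ hk hδ0 hm₀ (hsol w) hc hvb hC1 le_rfl hsmall x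
    refine h.trans ?_
    have h1 : ‖(w : ℂ) - δ * Complex.I‖ ≤ 2 * δ := by
      refine (norm_sub_le _ _).trans ?_
      rw [norm_mul, Complex.norm_I, mul_one, Complex.norm_real, Real.norm_of_nonneg hδ0.le]
      linarith
    calc _ ≤ 8 * C * V * (2 * δ) * V :=
          mul_le_mul (mul_le_mul_of_nonneg_left h1 (by positivity)) (hvb x).2
            (hm₀.im_pos x).le (by positivity)
      _ = δ * (16 * C * V * V) := by ring
      _ ≤ _ := (le_div_iff₀ (by positivity)).1 (min_le_right _ _)
  -- continuity along the part of the disc above a horizontal line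
  set η := min z.im δ with hη
  have hη0 : 0 < η := lt_min z.im_pos hδ0
  -- This set is convex, contains both z and iδ, and stays at height η, where the Lipschitz bound is
  -- uniform.
  set D : Set ℂ := {w | η ≤ w.im} ∩ Metric.closedBall 0 δ with hD
  have hDc : IsPreconnected D :=
    ((convex_halfSpace_im_ge η).inter (convex_closedBall 0 δ)).isPreconnected
  set g : ℂ → ℝ := fun w => ‖m (UpperHalfPlane.ofComplex w) - m z₀‖ with hg
  have hcoe : ∀ w ∈ D, ((UpperHalfPlane.ofComplex w : UpperHalfPlane) : ℂ) = w := fun w hw => by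
    rw [UpperHalfPlane.ofComplex_apply_of_im_pos (hη0.trans_le hw.1)]
  have hnorm : ∀ w ∈ D, ‖w‖ ≤ δ := fun w hw => by simpa using hw.2
  have hs0 := hk.nonneg_bound
  have hgc : ContinuousOn g D := by
    refine LipschitzOnWith.continuousOn (K := Real.toNNReal ((δ + s * (1 / η)) / η ^ 3))
      (LipschitzOnWith.of_dist_le_mul fun w hw w' hw' => ?_)
    rw [Real.coe_toNNReal _ (by positivity), Real.dist_eq]
    refine (abs_norm_sub_norm_le _ _).trans ?_
    rw [sub_sub_sub_cancel_right]
    refine BB.norm_le _ (by positivity) fun x => ?_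
    have h := (hsol (UpperHalfPlane.ofComplex w)).norm_sub_le hk
      (hsol (UpperHalfPlane.ofComplex w')) (R := δ) hη0
      (by rw [hcoe w hw]; exact hw.1) (by rw [hcoe w' hw']; exact hw'.1)
      (by rw [hcoe w hw]; exact hnorm w hw) (by rw [hcoe w' hw']; exact hnorm w' hw') x
    rw [hcoe w hw, hcoe w' hw'] at h
    rw [dist_eq_norm]
    exact h
  have hzD : (z : ℂ) ∈ D := ⟨min_le_left z.im δ, by simpa using hz⟩
  have hz₀D : (δ : ℂ) * Complex.I ∈ D := by
    refine ⟨?_, ?_⟩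
    · simp [hη]
    · simp [abs_of_pos hδ0]
  have hg₀ : g (δ * Complex.I) = 0 := by
    have : UpperHalfPlane.ofComplex ((δ : ℂ) * Complex.I) = z₀ :=
      UpperHalfPlane.ofComplex_apply_of_im_pos hδim
    simp [hg, this]
  have hgz : g z = ‖m z - m z₀‖ := by simp [hg]
  have hfin : ‖m z - m z₀‖ ≤ B := by
    by_contra hlt
    rw [not_le, ← hgz] at hlt
    -- A distance exceeding B at z would be exactly B somewhere on the set, which contradicts the
    -- bound B/2 of `hgap`.
    obtain ⟨w, hw, hwB⟩ := hDc.intermediate_value hz₀D hzD hgc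
      (⟨by rw [hg₀]; exact hB0.le, hlt.le⟩ : B ∈ Set.Icc _ _)
    have h := hgap (UpperHalfPlane.ofComplex w) (by rw [hcoe w hw]; exact hnorm w hw)
      (le_of_eq hwB)
    rw [show ‖m (UpperHalfPlane.ofComplex w) - m z₀‖ = B from hwB] at h
    linarith
  have hmz₀ : ‖m z₀‖ ≤ V := BB.norm_le _ hV.le fun x => by
    rw [hm₀.eq_mul_I hk hδ0 x, norm_mul, Complex.norm_I, mul_one, Complex.norm_real,
      Real.norm_of_nonneg (hm₀.im_pos x).le]
    exact (hvb x).2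
  calc ‖m z‖ = ‖m z₀ + (m z - m z₀)‖ := by rw [add_sub_cancel]
    _ ≤ V + B := (norm_add_le _ _).trans (add_le_add hmz₀ hfin)

end QVE

/-! ### The theorem -/

theorem mainTheorem8 :
    -- (i) neighborhood of zero, and the resulting global bound with the same constants
    (∀ (K : ℕ) (φ s : ℝ), 0 < φ → 0 < s →
      ∃ δ Φ : ℝ, 0 < δ ∧
        ∀ (X : Type u) [MeasurableSpace X] (π : MeasureTheory.Measure X)
          [MeasureTheory.IsProbabilityMeasure π]
          (S : QVE.BB X →L[ℂ] QVE.BB X) (k : X → X → ℝ) (m : UpperHalfPlane → QVE.BB X),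
          QVE.A1 π S → QVE.A2 π S k → QVE.B1 π k φ K → ‖S‖ ≤ s →
          QVE.IsSolution (fun _ => 0) S m →
          (∀ z : UpperHalfPlane, ‖(z : ℂ)‖ ≤ δ → ‖m z‖ ≤ Φ) ∧
          (ENNReal.ofReal (4 / δ ^ 2) < QVE.GamLim π (fun _ => 0) k →
            QVE.stripNorm Set.univ m ≤
              max (ENNReal.ofReal Φ)
                (ENNReal.ofReal (δ / 2) *
                  QVE.GamInv π (fun _ => 0) k (ENNReal.ofReal (4 / δ ^ 2))))) ∧
    -- (ii) away from zero
    (∀ (X : Type u) [MeasurableSpace X] (π : MeasureTheory.Measure X)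
      [MeasureTheory.IsProbabilityMeasure π]
      (S : QVE.BB X →L[ℂ] QVE.BB X) (k : X → X → ℝ) (m : UpperHalfPlane → QVE.BB X),
      QVE.A1 π S → QVE.A2 π S k → QVE.IsSolution (fun _ => 0) S m →
      ∀ z : UpperHalfPlane,
        2 / QVE.GamLim π (fun _ => 0) k ^ (1 / 2 : ℝ) < ENNReal.ofReal ‖(z : ℂ)‖ →
        ENNReal.ofReal ‖m z‖ ≤
          ENNReal.ofReal (‖(z : ℂ)‖ / 2) *
            QVE.GamInv π (fun _ => 0) k (ENNReal.ofReal (4 / ‖(z : ℂ)‖ ^ 2))) := by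
  refine ⟨fun K φ s hφ hs => ?_, ?_⟩
  · obtain ⟨δ, Φ, hδ, h⟩ := QVE.exists_bound_near_zero.{u} K hφ hs
    refine ⟨δ, Φ, hδ, ?_⟩
    intro X _ π _ S k m _ h2 hB hS hm
    have hk := h2.isKernel hS
    have hnear := h X π k m hk hB (QVE.IsSolution.isSol h2 hm)
    refine ⟨hnear, fun hlt => iSup_le fun z => iSup_le fun _ => ?_⟩
    rcases le_total ‖(z : ℂ)‖ δ with hz | hz
    · exact (ENNReal.ofReal_le_ofReal (hnear z hz)).trans (le_max_left _ _)
    · obtain ⟨D, hD⟩ := QVE.rowDist_bounded h2 (a := fun _ => 0) (A := 0) (by simp)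
      exact (QVE.BB.ofReal_norm_le _ fun x => (QVE.IsSolution.isSol h2 hm z).norm_le_GamInv hk
        z.im_pos hD hδ hz hlt x).trans (le_max_right _ _)
  · intro X _ π _ S k m _ h2 hm z hz
    obtain ⟨D, hD⟩ := QVE.rowDist_bounded h2 (a := fun _ => 0) (A := 0) (by simp)
    have hzn : 0 < ‖(z : ℂ)‖ := norm_pos_iff.2 z.ne_zero
    -- The pointwise bound is used with d = |z|.
    exact QVE.BB.ofReal_norm_le _ fun x => (QVE.IsSolution.isSol h2 hm z).norm_le_GamInv
      (h2.isKernel le_rfl) z.im_pos hD hzn le_rfl (QVE.ofReal_lt_of_two_div_sqrt_lt hzn hz) x
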